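/- Let $p$ be a prime, let $K$ be a finite extension of $\mathbf{Q}_p$ with ramification index $e_K$ (over $\mathbf{Q}_p$) and residue field $k$, and let $L$ be a finite Galois extension of $K$ with group $G=\mathrm{Gal}(L|K)$ which is tamely ramified and split over $K$, i.e. the exact sequence $1\to T\to G\to G/T\to 1$, where $T\subset G$ is the inertia subgroup, has a section that is a group homomorphism. Let $e_L$ be the ramification index of $L$ over $\mathbf{Q}_p$, let $\mathfrak{o}_L$ be the ring of integers of $L$ and $\mathfrak{p}_L$ its maximal ideal, put $U_L^r=1+\mathfrak{p}_L^r$ for $r>0$, and let $\bar U_L^r$ be the image of $U_L^r$ in the $\mathbf{F}_p[G]$-module $L^\times/L^{\times p}$. Let ${}_pL^\times=\{x\in L^\times : x^p=1\}$, and let $\bar{\mathbf{F}}_p$ be an algebraic closure of $\mathbf{F}_p$. (a) If ${}_pL^\times$ has order $p$, then $p-1$ divides $e_L$ and, writing $e_L=c(p-1)$ and $M=\bar U_L^1/\bar U_L^{cp}$, there is an isomorphism of $\bar{\mathbf{F}}_p[G]$-modules $$M\otimes_{\mathbf{F}_p[G]}\bar{\mathbf{F}}_p[G]\;\cong\;\bar{\mathbf{F}}_p[G]^{[K:\mathbf{Q}_p]}.$$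 (b) If ${}_pL^\times$ is trivial but $p-1$ divides $e_L$, then $\bar U_L^1$ is equal to the image of $\mathfrak{o}_L^\times$ in $L^\times/L^{\times p}$, and there are isomorphisms of $\mathbf{F}_p[G]$-modules $$\bar U_L^1\;\cong\; k[G]^{e_K}\;\cong\;\mathbf{F}_p[G]^{[K:\mathbf{Q}_p]}.$$ -/

import Mathlib

set_option linter.unusedSectionVars false

noncomputable section

namespace LocalGalMod

open scoped TensorProduct

/-! ### The ring of integers of a finite extension of `ℚ_p` -/

section Integers

variable (p : ℕ) [Fact p.Prime] (K : Type*) [Field K] [Algebra ℚ_[p] K] [Algebra ℤ_[p] K]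
  [IsScalarTower ℤ_[p] ℚ_[p] K]

/-- The ring of integers `𝔬_K` of `K`: the integral closure of `ℤ_p` in `K`. -/
abbrev IntRing : Subalgebra ℤ_[p] K := integralClosure ℤ_[p] K

theorem isIntegral_iff_spectralNorm_le [FiniteDimensional ℚ_[p] K] (x : K) :
    IsIntegral ℤ_[p] x ↔ spectralNorm ℚ_[p] K x ≤ 1 := by
  have hx : IsIntegral ℚ_[p] x := Algebra.IsIntegral.isIntegral x
  unfold spectralNorm
  rw [spectralValue_le_one_iff (minpoly.monic hx)]
  constructor
  · intro h n
    rw [minpoly.isIntegrallyClosed_eq_field_fractions' ℚ_[p] h, Polynomial.coeff_map]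
    exact ((minpoly ℤ_[p] x).coeff n).2
  · intro h
    have hl : minpoly ℚ_[p] x ∈ Polynomial.lifts (algebraMap ℤ_[p] ℚ_[p]) := by
      rw [Polynomial.lifts_iff_coeff_lifts]
      exact fun n => ⟨⟨_, h n⟩, rfl⟩
    obtain ⟨q, hq, -, hm⟩ := Polynomial.lifts_and_degree_eq_and_monic hl (minpoly.monic hx)
    refine ⟨q, hm, ?_⟩
    have h0 := minpoly.aeval ℚ_[p] x
    rw [← hq, Polynomial.aeval_map_algebraMap] at h0
    exact h0

variable {p K} in
theorem isUnit_intRing_iff [FiniteDimensional ℚ_[p] K] (x : IntRing p K) :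
    IsUnit x ↔ spectralNorm ℚ_[p] K (x : K) = 1 := by
  have hle : ∀ y : IntRing p K, spectralNorm ℚ_[p] K (y : K) ≤ 1 := fun y =>
    (isIntegral_iff_spectralNorm_le p K _).1 y.2
  have hmul : ∀ y z : K, spectralNorm ℚ_[p] K (y * z)
      = spectralNorm ℚ_[p] K y * spectralNorm ℚ_[p] K z :=
    fun y z => spectralAlgNorm_mul (K := ℚ_[p]) y z
  constructor
  · rintro hu
    obtain ⟨y, hy⟩ := hu.exists_right_inv
    have h1 : spectralNorm ℚ_[p] K (x : K) * spectralNorm ℚ_[p] K (y : K) = 1 := by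
      rw [← hmul, ← Subalgebra.coe_mul, hy, Subalgebra.coe_one, spectralNorm_one]
    have := hle x
    have := hle y
    have := spectralNorm_nonneg (K := ℚ_[p]) (x : K)
    nlinarith
  · intro h
    have hx0 : (x : K) ≠ 0 := by
      intro h0
      rw [h0, spectralNorm_zero] at h
      exact zero_ne_one h
    have hi : spectralNorm ℚ_[p] K (x : K)⁻¹ = 1 := by
      have := hmul (x : K) (x : K)⁻¹
      rw [mul_inv_cancel₀ hx0, spectralNorm_one, h, one_mul] at this
      exact this.symm
    refine IsUnit.of_mul_eq_one ⟨(x : K)⁻¹, (isIntegral_iff_spectralNorm_le p K _).2 hi.le⟩ ?_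
    ext
    simp [hx0]

instance isLocalRing_intRing [FiniteDimensional ℚ_[p] K] : IsLocalRing (IntRing p K) := by
  have hle : ∀ y : IntRing p K, spectralNorm ℚ_[p] K (y : K) ≤ 1 := fun y =>
    (isIntegral_iff_spectralNorm_le p K _).1 y.2
  refine IsLocalRing.of_nonunits_add fun a b ha hb => ?_
  rw [mem_nonunits_iff, isUnit_intRing_iff] at ha hb ⊢
  have h1 := lt_of_le_of_ne (hle a) ha
  have h2 := lt_of_le_of_ne (hle b) hb
  have h3 := isNonarchimedean_spectralNorm (K := ℚ_[p]) (a : K) (b : K)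
  exact (lt_of_le_of_lt h3 (max_lt h1 h2)).ne

variable [FiniteDimensional ℚ_[p] K]

/-- The maximal ideal `𝔭_K` of `𝔬_K`. -/
abbrev maxIdeal : Ideal (IntRing p K) := IsLocalRing.maximalIdeal (IntRing p K)

/-- The absolute ramification index `e_K` of `K` over `ℚ_p`. -/
abbrev absRam : ℕ := (maxIdeal p K).ramificationIdx ℤ_[p]

/-- The residue field `k` of `K`. -/
abbrev ResField : Type _ := IsLocalRing.ResidueField (IntRing p K)

instance charP_resField : CharP (ResField p K) p := by
  rw [CharP.charP_iff_prime_eq_zero Fact.out, ← map_natCast (IsLocalRing.residue (IntRing p K)) p,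
    IsLocalRing.residue_eq_zero_iff, IsLocalRing.mem_maximalIdeal, mem_nonunits_iff,
    isUnit_intRing_iff]
  have h : ((p : IntRing p K) : K) = algebraMap ℚ_[p] K p := by simp
  rw [h, spectralNorm_extends]
  exact Padic.norm_p_lt_one.ne

/-- The structure of `𝔽_p`-algebra on the residue field. -/
instance algebraResField : Algebra (ZMod p) (ResField p K) := ZMod.algebra _ p

/-- `k[G]` as an `𝔽_p[G]`-module, through the ring map `𝔽_p[G] → k[G]`. -/
instance moduleResFieldGroupAlgebra (G : Type*) [Group G] :
    Module (MonoidAlgebra (ZMod p) G) (MonoidAlgebra (ResField p K) G) :=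
  Module.compHom _ (MonoidAlgebra.mapRingHom G (algebraMap (ZMod p) (ResField p K)))

end Integers

/-! ### The extension `L | K` -/

section Extension

variable (p : ℕ) [Fact p.Prime] (K L : Type*) [Field K] [Field L] [Algebra K L]
  [Algebra ℚ_[p] K] [Algebra ℚ_[p] L] [IsScalarTower ℚ_[p] K L]
  [Algebra ℤ_[p] K] [IsScalarTower ℤ_[p] ℚ_[p] K]
  [Algebra ℤ_[p] L] [IsScalarTower ℤ_[p] ℚ_[p] L] [IsScalarTower ℤ_[p] K L]
  [FiniteDimensional ℚ_[p] K] [FiniteDimensional ℚ_[p] L]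

/-- `𝔬_L` as an `𝔬_K`-algebra. -/
instance algebraIntRing : Algebra (IntRing p K) (IntRing p L) :=
  ((IsScalarTower.toAlgHom ℤ_[p] K L).mapIntegralClosure : IntRing p K →+* IntRing p L).toAlgebra

/-- `L | K` is tamely ramified: its ramification index is prime to `p` (the residue fields
are finite, so the residual extension is separable). -/
def IsTame : Prop := ¬ p ∣ (maxIdeal p L).ramificationIdx (IntRing p K)

/-- The inertia subgroup `T` of `Gal(L | K)`: the automorphisms acting trivially on the residue
field `𝔬_L / 𝔭_L`. -/
abbrev inertiaGroup : Subgroup Gal(L/K) := (maxIdeal p L).inertia Gal(L/K)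

instance normal_inertiaGroup : (inertiaGroup p K L).Normal where
  conj_mem t ht g x := by
    have h := ht (g⁻¹ • x)
    have e : (g * t * g⁻¹) • x - x = g • (t • (g⁻¹ • x) - g⁻¹ • x) := by
      rw [smul_sub, smul_inv_smul, mul_smul, mul_smul]
    rw [e]
    change g • _ ∈ maxIdeal p L
    rw [IsLocalRing.mem_maximalIdeal, mem_nonunits_iff] at *
    intro hu
    have h' : ¬ IsUnit (t • (g⁻¹ • x) - g⁻¹ • x) := h
    exact h' (by simpa using hu.map (MulSemiringAction.toRingHom Gal(L/K) (IntRing p L) g⁻¹))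

/-- `L` is split over `K`: the exact sequence `1 → T → G → G/T → 1` has a section which is a
homomorphism of groups. -/
def IsSplitExt : Prop :=
  ∃ s : Gal(L/K) ⧸ inertiaGroup p K L →* Gal(L/K),
    ∀ x, QuotientGroup.mk' (inertiaGroup p K L) (s x) = x

end Extension

/-! ### `L^× / L^{× p}` and its submodules -/

section PowQuotient

variable (p : ℕ) [Fact p.Prime] (K L : Type*) [Field K] [Field L] [Algebra K L]

/-- The subgroup `L^{× p}` of `p`-th powers in `L^×`. -/
abbrev pthPowers : Subgroup Lˣ := (powMonoidHom p : Lˣ →* Lˣ).range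

/-- The group `L^× / L^{× p}`, written additively. -/
def UnitsModP : Type _ := Additive (Lˣ ⧸ pthPowers p L)

instance addCommGroupUnitsModP : AddCommGroup (UnitsModP p L) :=
  inferInstanceAs (AddCommGroup (Additive (Lˣ ⧸ pthPowers p L)))

/-- The class in `L^× / L^{× p}` of an element of `L^×`. -/
def toUnitsModP : Additive Lˣ →+ UnitsModP p L :=
  MonoidHom.toAdditive (QuotientGroup.mk' (pthPowers p L))

variable {p L} in
theorem toUnitsModP_surjective (x : UnitsModP p L) :
    ∃ u : Lˣ, toUnitsModP p L (.ofMul u) = x := by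
  obtain ⟨u, hu⟩ := QuotientGroup.mk'_surjective (pthPowers p L) (Additive.toMul x)
  exact ⟨u, congrArg Additive.ofMul hu⟩

instance moduleZModUnitsModP : Module (ZMod p) (UnitsModP p L) :=
  AddCommGroup.zmodModule (n := p) fun x => by
    obtain ⟨u, rfl⟩ := toUnitsModP_surjective x
    rw [← map_nsmul, ← ofMul_pow]
    exact congrArg Additive.ofMul ((QuotientGroup.eq_one_iff _).2 ⟨u, rfl⟩)

/-- The map induced on `L^× / L^{× p}` by an automorphism of `L`. -/
def galMap (g : Gal(L/K)) : UnitsModP p L →+ UnitsModP p L :=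
  MonoidHom.toAdditive <| QuotientGroup.map (pthPowers p L) (pthPowers p L)
    (Units.map (g : L →* L)) (by
      rintro _ ⟨u, rfl⟩
      exact ⟨Units.map (g : L →* L) u, by simp⟩)

variable {K L} in
theorem galMap_toUnitsModP (g : Gal(L/K)) (u : Lˣ) :
    galMap p K L g (toUnitsModP p L (.ofMul u)) =
      toUnitsModP p L (.ofMul (Units.map (g : L →* L) u)) := rfl

/-- The `𝔽_p`-linear representation of `Gal(L | K)` on `L^× / L^{× p}`. -/
def galRep : Representation (ZMod p) Gal(L/K) (UnitsModP p L) where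
  toFun g := (galMap p K L g).toZModLinearMap p
  map_one' := by
    ext x
    obtain ⟨u, rfl⟩ := toUnitsModP_surjective x
    rfl
  map_mul' g h := by
    ext x
    obtain ⟨u, rfl⟩ := toUnitsModP_surjective x
    rfl

/-- `L^× / L^{× p}` as an `𝔽_p[G]`-module, `G = Gal(L | K)`. -/
instance moduleGroupAlgebraUnitsModP :
    Module (MonoidAlgebra (ZMod p) Gal(L/K)) (UnitsModP p L) :=
  Module.compHom _ (galRep p K L).asAlgebraHom.toRingHom

/-- The image in `L^× / L^{× p}` of a `G`-stable subgroup of `L^×`, as an `𝔽_p[G]`-submodule. -/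
def imageSubmodule (H : Subgroup Lˣ)
    (hH : ∀ g : Gal(L/K), ∀ u ∈ H, Units.map (g : L →* L) u ∈ H) :
    Submodule (MonoidAlgebra (ZMod p) Gal(L/K)) (UnitsModP p L) where
  __ := (Subgroup.toAddSubgroup H).map (toUnitsModP p L)
  smul_mem' a x hx := by
    change (galRep p K L).asAlgebraHom a x ∈ (Subgroup.toAddSubgroup H).map (toUnitsModP p L)
    induction a using MonoidAlgebra.induction_linear with
    | zero => simp
    | add f g hf hg => simpa using add_mem hf hg
    | single g c =>
      rw [Representation.asAlgebraHom_single, LinearMap.smul_apply]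
      obtain ⟨u, hu, rfl⟩ := hx
      rw [← ZMod.natCast_zmod_val c, Nat.cast_smul_eq_nsmul]
      have h : galRep p K L g (toUnitsModP p L u) ∈
          (Subgroup.toAddSubgroup H).map (toUnitsModP p L) :=
        ⟨.ofMul (Units.map (g : L →* L) u.toMul), hH g _ hu, rfl⟩
      exact nsmul_mem h _

end PowQuotient

section UnitFiltration

variable (p : ℕ) [Fact p.Prime] (K L : Type*) [Field K] [Field L] [Algebra K L]
  [Algebra ℚ_[p] K] [Algebra ℚ_[p] L] [IsScalarTower ℚ_[p] K L]
  [Algebra ℤ_[p] K] [IsScalarTower ℤ_[p] ℚ_[p] K]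
  [Algebra ℤ_[p] L] [IsScalarTower ℤ_[p] ℚ_[p] L] [IsScalarTower ℤ_[p] K L]
  [FiniteDimensional ℚ_[p] K] [FiniteDimensional ℚ_[p] L]

/-- `𝔬_L^×` as a subgroup of `L^×`. -/
def intUnits : Subgroup Lˣ :=
  (Units.map ((IntRing p L).val : IntRing p L →* L)).range

/-- `U_L^r`: the units of `𝔬_L` congruent to `1` modulo `𝔭_L^r`. For `r > 0` this is
`1 + 𝔭_L^r`. -/
def unitGroup (r : ℕ) : Subgroup Lˣ :=
  (Units.map (Ideal.Quotient.mk (maxIdeal p L ^ r) :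
    IntRing p L →* IntRing p L ⧸ maxIdeal p L ^ r)).ker.map
    (Units.map ((IntRing p L).val : IntRing p L →* L))

theorem mem_unitGroup_iff {r : ℕ} (hr : 0 < r) (u : Lˣ) :
    u ∈ unitGroup p L r ↔ ∃ a ∈ maxIdeal p L ^ r, (u : L) = 1 + (a : L) := by
  constructor
  · rintro ⟨v, hv, rfl⟩
    refine ⟨(v : IntRing p L) - 1, ?_, by simp⟩
    have h := congrArg Units.val (MonoidHom.mem_ker.1 hv)
    rw [← Ideal.Quotient.eq_zero_iff_mem, map_sub, map_one, sub_eq_zero]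
    exact h
  · rintro ⟨a, ha, hu⟩
    have h1 : IsUnit (1 + a) := by
      have ha' : a ∈ maxIdeal p L := Ideal.pow_le_self hr.ne' ha
      by_contra hn
      have := sub_mem (show 1 + a ∈ maxIdeal p L from hn) ha'
      rw [add_sub_cancel_right] at this
      exact this isUnit_one
    refine ⟨h1.unit, ?_, ?_⟩
    · change Units.map _ _ = 1
      ext
      change Ideal.Quotient.mk (maxIdeal p L ^ r) (1 + a) = 1
      rw [map_add, map_one, Ideal.Quotient.eq_zero_iff_mem.2 ha, add_zero]
    · ext
      simpa using hu.symm

variable {p K L} in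
theorem intUnits_galStable (g : Gal(L/K)) (u : Lˣ) (hu : u ∈ intUnits p L) :
    Units.map (g : L →* L) u ∈ intUnits p L := by
  obtain ⟨v, rfl⟩ := hu
  exact ⟨Units.map (MulSemiringAction.toRingHom Gal(L/K) (IntRing p L) g : _ →* _) v, rfl⟩

variable {p K L} in
theorem unitGroup_galStable (r : ℕ) (g : Gal(L/K)) (u : Lˣ) (hu : u ∈ unitGroup p L r) :
    Units.map (g : L →* L) u ∈ unitGroup p L r := by
  obtain ⟨v, hv, rfl⟩ := hu
  refine ⟨Units.map (MulSemiringAction.toRingHom Gal(L/K) (IntRing p L) g : _ →* _) v, ?_, rfl⟩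
  have h : Ideal.Quotient.mk (maxIdeal p L ^ r) (v : IntRing p L) = 1 :=
    congrArg Units.val (MonoidHom.mem_ker.1 hv)
  rw [← map_one (Ideal.Quotient.mk (maxIdeal p L ^ r)), Ideal.Quotient.eq] at h
  have hm : (maxIdeal p L).map (MulSemiringAction.toRingHom Gal(L/K) (IntRing p L) g)
      ≤ maxIdeal p L := by
    rw [Ideal.map_le_iff_le_comap]
    intro x hx hu
    exact hx (by simpa using hu.map (MulSemiringAction.toRingHom Gal(L/K) (IntRing p L) g⁻¹))
  have h2 := Ideal.mem_map_of_mem (MulSemiringAction.toRingHom Gal(L/K) (IntRing p L) g) h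
  rw [Ideal.map_pow] at h2
  have h3 := Ideal.pow_right_mono hm r h2
  rw [map_sub, map_one, ← Ideal.Quotient.eq, map_one] at h3
  exact MonoidHom.mem_ker.2 (Units.ext h3)

/-- `Ū_L^r`: the image of `U_L^r` in `L^× / L^{× p}`, an `𝔽_p[G]`-submodule. -/
abbrev unitBar (r : ℕ) : Submodule (MonoidAlgebra (ZMod p) Gal(L/K)) (UnitsModP p L) :=
  imageSubmodule p K L (unitGroup p L r) (unitGroup_galStable r)

/-- The image of `𝔬_L^×` in `L^× / L^{× p}`, an `𝔽_p[G]`-submodule. -/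
abbrev intUnitsBar : Submodule (MonoidAlgebra (ZMod p) Gal(L/K)) (UnitsModP p L) :=
  imageSubmodule p K L (intUnits p L) intUnits_galStable

/-- The `𝔽_p[G]`-module `Ū_L^1 / Ū_L^s` (for `s ≥ 1`). -/
abbrev unitBarQuot (s : ℕ) : Type _ :=
  (unitBar p K L 1) ⧸ (unitBar p K L s).submoduleOf (unitBar p K L 1)

end UnitFiltration

/-! ### Extension of scalars over noncommutative rings -/

section BaseChange

variable {R S : Type*} [Ring R] [Ring S] (f : R →+* S) (M : Type*) [AddCommGroup M] [Module R M]

/-- The relations `s f(r) ⊗ m = s ⊗ r m`, as an `S`-submodule of `S ⊗_ℤ M`. -/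
def balancedRel : Submodule S (S ⊗[ℤ] M) :=
  Submodule.span S {x | ∃ (s : S) (r : R) (m : M), x = (s * f r) ⊗ₜ[ℤ] m - s ⊗ₜ[ℤ] (r • m)}

/-- The `S`-module deduced from the left `R`-module `M` by extension of scalars along
`f : R → S`, that is, the tensor product of `S` and `M` over `R`. -/
abbrev ScalarExt : Type _ := (S ⊗[ℤ] M) ⧸ balancedRel f M

end BaseChange

end LocalGalMod

end

open LocalGalMod

set_option linter.unusedSectionVars false

namespace LocalGalMod

noncomputable section

/-! Write l for the residue field of L, e for the ramification index of L over K, and e_L = c(p -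
1). Filter Ū^1/Ū^{cp} by the images of the U^n. Expanding (1 + x)^p, the terms p·x and x^p have
equal valuation exactly when x has valuation c. Hence below cp every p-th power that is a principal
unit starts in a degree divisible by p, and all such degrees are reached: the graded piece vanishes
if p ∣ n (`unitBarMod_le_succ`). If p ∤ n it is l with G acting through x ↦ χ(g)^n g(x), where χ(g)
is the residue of g(π)/π (`exists_unitBarMod_linearMap`). Splitness provides a uniformizer π fixed
by a complement of T, and tameness makes χ faithful on T. A normal basis argument over G/T and a
Vandermonde determinant over T then show that any e consecutive twists sum to k[G]
(`nonempty_twist_block_equiv`). So every twist is projective and the filtration splits. Frobenius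
identifies the n-th twist with the pn-th. Multiplying by powers of p moves the degrees prime to p in
[1, cp) bijectively onto (c, cp] (`exists_equiv_not_dvd`). That interval has c(p - 1) = e_K·e
elements, hence consists of e_K blocks, giving k[G]^{e_K}, which is free over F_p[G] of rank [K :
Q_p] (`nonempty_unitBarQuot_equiv`). In (a), a p-th root of unity ζ ≠ 1 forces e_L = c(p - 1), with
c the valuation of ζ - 1. In (b), Hensel's lemma shows that U^{cp} consists of p-th powers, so the
quotient is Ū^1 itself (`unitBar_eq_bot`). -/

open IsLocalRing Module

/-! ### The degree formula n = ef for local domains. -/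

section LocalRings

/-- The fundamental identity for an extension of local domains. -/
theorem finrank_eq_ramificationIdx_mul_inertiaDeg (R S : Type*) [CommRing R] [IsDomain R]
    [IsLocalRing R] [CommRing S] [IsLocalRing S] [Algebra R S] [IsLocalHom (algebraMap R S)]
    [Module.Finite R S] [Module.Flat R S] :
    finrank R S = (maximalIdeal S).ramificationIdx R * (maximalIdeal S).inertiaDeg R := by
  let P : (maximalIdeal R).primesOver S := ⟨maximalIdeal S, inferInstance, inferInstance⟩
  have hP : ∀ Q : (maximalIdeal R).primesOver S, Q = P := fun ⟨Q, hQ, hQR⟩ => by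
    have : Q.IsMaximal := Ideal.isMaximal_of_isIntegral_of_isMaximal_comap (R := R) Q
      (by rw [← Ideal.under_def, ← hQR.over]; infer_instance)
    exact Subtype.ext (eq_maximalIdeal this)
  let : Unique ((maximalIdeal R).primesOver S) := ⟨⟨P⟩, hP⟩
  rw [← Ideal.sum_ramification_inertia_eq_finrank (maximalIdeal R) S, Fintype.sum_unique]
  rfl

end LocalRings

/-! ### The ring of integers as a discrete valuation ring with finite residue field. -/

section IntRingStructure

variable (p : ℕ) [Fact p.Prime] (L : Type*) [Field L] [Algebra ℚ_[p] L] [Algebra ℤ_[p] L]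
  [IsScalarTower ℤ_[p] ℚ_[p] L] [FiniteDimensional ℚ_[p] L]

instance isDedekindDomain_intRing : IsDedekindDomain (IntRing p L) :=
  IsIntegralClosure.isDedekindDomain ℤ_[p] ℚ_[p] L (IntRing p L)

instance finite_intRing : Module.Finite ℤ_[p] (IntRing p L) :=
  IsIntegralClosure.finite ℤ_[p] ℚ_[p] L (IntRing p L)

instance isFractionRing_intRing : IsFractionRing (IntRing p L) L :=
  IsIntegralClosure.isFractionRing_of_finite_extension ℤ_[p] ℚ_[p] L (IntRing p L)

instance isTorsionFree_intRing : IsTorsionFree ℤ_[p] (IntRing p L) := by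
  have : FaithfulSMul ℤ_[p] L := by
    rw [faithfulSMul_iff_algebraMap_injective, IsScalarTower.algebraMap_eq ℤ_[p] ℚ_[p] L]
    exact (algebraMap ℚ_[p] L).injective.comp (IsFractionRing.injective ℤ_[p] ℚ_[p])
  have : FaithfulSMul ℤ_[p] (IntRing p L) := by
    rw [faithfulSMul_iff_algebraMap_injective]
    have h := FaithfulSMul.algebraMap_injective ℤ_[p] L
    rw [IsScalarTower.algebraMap_eq ℤ_[p] (IntRing p L) L] at h
    exact Function.Injective.of_comp (f := algebraMap (IntRing p L) L) h
  infer_instance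

theorem natCast_intRing_ne_zero : (p : IntRing p L) ≠ 0 := by
  have h := FaithfulSMul.algebraMap_injective ℤ_[p] (IntRing p L)
  rw [← map_natCast (algebraMap ℤ_[p] (IntRing p L)), map_ne_zero_iff _ h]
  exact PadicInt.prime_p.ne_zero

theorem natCast_mem_maxIdeal : (p : IntRing p L) ∈ maxIdeal p L := by
  rw [← residue_eq_zero_iff, map_natCast]
  exact CharP.cast_eq_zero _ p

theorem not_isField_intRing : ¬ IsField (IntRing p L) := by
  intro h
  have h0 := natCast_mem_maxIdeal p L
  rw [maxIdeal, isField_iff_maximalIdeal_eq.1 h] at h0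
  exact natCast_intRing_ne_zero p L h0

instance isDiscreteValuationRing_intRing : IsDiscreteValuationRing (IntRing p L) :=
  ((IsDiscreteValuationRing.TFAE (IntRing p L) (not_isField_intRing p L)).out 0 2 rfl rfl).2
    inferInstance

instance isLocalHom_padicInt_intRing : IsLocalHom (algebraMap ℤ_[p] (IntRing p L)) :=
  inferInstance

instance finite_resField : Finite (ResField p L) := by
  have : Module.Finite (ResidueField ℤ_[p]) (ResField p L) := inferInstance
  have : Finite (ResidueField ℤ_[p]) := Finite.of_equiv _ PadicInt.residueField.symm.toEquiv
  exact Module.finite_of_finite (ResidueField ℤ_[p])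

theorem natCard_resField :
    Nat.card (ResField p L) = p ^ (maxIdeal p L).inertiaDeg ℤ_[p] := by
  have h := Ideal.inertiaDeg_eq_of_isMaximal (maximalIdeal ℤ_[p]) (maxIdeal p L)
  rw [h]
  have h2 := Module.natCard_eq_pow_finrank (K := ResidueField ℤ_[p]) (V := ResField p L)
  rw [Nat.card_congr PadicInt.residueField.toEquiv, Nat.card_zmod] at h2
  exact h2

theorem finrank_eq_absRam_mul :
    finrank ℚ_[p] L = absRam p L * (maxIdeal p L).inertiaDeg ℤ_[p] := by
  rw [← finrank_eq_ramificationIdx_mul_inertiaDeg,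
    IsFractionRing.finrank_eq ℤ_[p] ℚ_[p] (IntRing p L) L]

/-- Turns the ideal-theoretic ramification index into the valuation of p, the form used in all
estimates on p-th powers. -/
theorem associated_natCast_pow {π : IntRing p L} (hπ : Irreducible π) :
    Associated (p : IntRing p L) (π ^ absRam p L) := by
  obtain ⟨n, hn⟩ :=
    IsDiscreteValuationRing.associated_pow_irreducible (natCast_intRing_ne_zero p L) hπ
  have hm : (maximalIdeal ℤ_[p]).map (algebraMap ℤ_[p] (IntRing p L)) = maxIdeal p L ^ n := by
    rw [PadicInt.maximalIdeal_eq_span_p, Ideal.map_span, Set.image_singleton, map_natCast,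
      maxIdeal, hπ.maximalIdeal_eq, Ideal.span_singleton_pow, Ideal.span_singleton_eq_span_singleton]
    exact hn
  have h0 : maxIdeal p L ≠ ⊥ := IsDiscreteValuationRing.not_a_field _
  have h := Ideal.IsDedekindDomain.ramificationIdx_eq_multiplicity (maximalIdeal ℤ_[p])
    (maxIdeal p L) (by rw [hm]; exact pow_ne_zero n h0)
  rw [hm, multiplicity_pow_self h0 (by
    rw [Ideal.isUnit_iff]; exact Ideal.IsPrime.ne_top inferInstance)] at h
  rwa [absRam, h]

theorem absRam_pos : 0 < absRam p L := Ideal.ramificationIdx_pos _ _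

end IntRingStructure

/-! ### Ramification, inertia and the order of the Galois group. -/

section ExtensionStructure

variable (p : ℕ) [Fact p.Prime] (K L : Type*) [Field K] [Field L] [Algebra K L]
  [Algebra ℚ_[p] K] [Algebra ℚ_[p] L] [IsScalarTower ℚ_[p] K L]
  [Algebra ℤ_[p] K] [IsScalarTower ℤ_[p] ℚ_[p] K]
  [Algebra ℤ_[p] L] [IsScalarTower ℤ_[p] ℚ_[p] L] [IsScalarTower ℤ_[p] K L]
  [FiniteDimensional ℚ_[p] K] [FiniteDimensional ℚ_[p] L]

instance isScalarTower_intRing_left : IsScalarTower ℤ_[p] (IntRing p K) (IntRing p L) :=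
  .of_algebraMap_eq fun x => by
    ext
    exact IsScalarTower.algebraMap_apply ℤ_[p] K L x

instance isScalarTower_intRing_right : IsScalarTower (IntRing p K) (IntRing p L) L :=
  .of_algebraMap_eq fun _ => rfl

instance isScalarTower_intRing_field : IsScalarTower (IntRing p K) K L :=
  .of_algebraMap_eq fun _ => rfl

instance finite_intRing_intRing : Module.Finite (IntRing p K) (IntRing p L) :=
  Module.Finite.of_restrictScalars_finite ℤ_[p] _ _

instance faithfulSMul_intRing_intRing : FaithfulSMul (IntRing p K) (IntRing p L) := by
  rw [faithfulSMul_iff_algebraMap_injective]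
  intro x y h
  ext
  exact (algebraMap K L).injective (congrArg Subtype.val h)

instance isTorsionFree_intRing_intRing : IsTorsionFree (IntRing p K) (IntRing p L) :=
  Module.IsTorsionFree.of_smul_eq_zero fun r x h => by
    rw [Algebra.smul_def, mul_eq_zero, FaithfulSMul.algebraMap_eq_zero_iff] at h
    exact h

instance isLocalHom_intRing : IsLocalHom (algebraMap (IntRing p K) (IntRing p L)) :=
  inferInstance

instance isGaloisGroup_intRing [IsGalois K L] :
    IsGaloisGroup Gal(L/K) (IntRing p K) (IntRing p L) :=
  IsGaloisGroup.of_isFractionRing Gal(L/K) (IntRing p K) (IntRing p L) K L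

theorem absRam_tower :
    absRam p L = absRam p K * (maxIdeal p L).ramificationIdx (IntRing p K) :=
  Ideal.ramificationIdx_tower _ _

theorem natCard_resField_tower :
    Nat.card (ResField p L) =
      Nat.card (ResField p K) ^ (maxIdeal p L).inertiaDeg (IntRing p K) := by
  rw [natCard_resField, natCard_resField, ← pow_mul, ← Ideal.inertiaDeg_tower]

include p in
theorem finite_gal : Finite Gal(L/K) :=
  have : FiniteDimensional K L := FiniteDimensional.right ℚ_[p] K L
  inferInstance

variable [IsGalois K L]

theorem natCard_inertiaGroup :
    Nat.card (inertiaGroup p K L) = (maxIdeal p L).ramificationIdx (IntRing p K) := by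
  have := finite_gal p K L
  have : Finite (IntRing p K ⧸ maxIdeal p K) := finite_resField p K
  have : Finite (maxIdeal p K).ResidueField :=
    Finite.of_surjective _ (maxIdeal p K).bijective_algebraMap_quotient_residueField.surjective
  have h := Ideal.card_inertia_eq_ramificationIdxIn (G := Gal(L/K)) (maxIdeal p K) (maxIdeal p L)
  rw [Ideal.ramificationIdxIn_eq_ramificationIdx (maxIdeal p K) (maxIdeal p L) Gal(L/K)] at h
  exact h

theorem natCard_gal :
    Nat.card Gal(L/K) = (maxIdeal p L).ramificationIdx (IntRing p K) *
      (maxIdeal p L).inertiaDeg (IntRing p K) := by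
  have := finite_gal p K L
  rw [IsGaloisGroup.card_eq_finrank' Gal(L/K) (IntRing p K) (IntRing p L),
    finrank_eq_ramificationIdx_mul_inertiaDeg]

end ExtensionStructure

/-! ### Completeness of the ring of integers. -/

section Completeness

theorem Basis.repr_mem_of_mem_map {R S ι : Type*} [CommRing R] [CommRing S] [Algebra R S]
    (b : Basis ι R S) (I : Ideal R) {x : S} (hx : x ∈ I.map (algebraMap R S)) (i : ι) :
    b.repr x i ∈ I := by
  have hx' : x ∈ (I • ⊤ : Submodule R S) := by
    rw [Ideal.smul_top_eq_map]
    exact hx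
  refine Submodule.smul_induction_on hx' (fun r hr s _ => ?_) (fun x y hx hy => ?_)
  · rw [map_smul, Finsupp.smul_apply, smul_eq_mul]
    exact I.mul_mem_right _ hr
  · rw [map_add, Finsupp.add_apply]
    exact add_mem hx hy

/-- A finite free algebra over an adically complete ring is precomplete for every ideal defining the
same topology as the extended ideal. -/
theorem isPrecomplete_of_free {R S : Type*} [CommRing R] [CommRing S] [Algebra R S]
    [Module.Free R S] [Module.Finite R S] (I : Ideal R) [IsPrecomplete I R] (J : Ideal S)
    (hIJ : I.map (algebraMap R S) ≤ J) {e : ℕ} (he : 0 < e)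
    (hJI : J ^ e ≤ I.map (algebraMap R S)) : IsPrecomplete J S where
  prec' x hx := by
    simp only [smul_eq_mul, Ideal.mul_top, SModEq.sub_mem] at hx ⊢
    let b := Module.Free.chooseBasis R S
    -- Since J^(em) lies in the extension of I^m, the coordinates of the subsequence x(en) are
    -- I-adically Cauchy and limits can be taken coordinatewise.
    have hy : ∀ {m n : ℕ}, m ≤ n →
        x (e * m) - x (e * n) ∈ (I ^ m).map (algebraMap R S) := fun {m n} hmn => by
      rw [Ideal.map_pow]
      refine Ideal.pow_right_mono hJI m ?_
      rw [← pow_mul]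
      exact hx (Nat.mul_le_mul_left e hmn)
    have hc : ∀ i, ∃ l : R, ∀ n, b.repr (x (e * n)) i - l ∈ I ^ n := fun i => by
      obtain ⟨l, hl⟩ := IsPrecomplete.prec (I := I) inferInstance
        (f := fun n => b.repr (x (e * n)) i) fun {m n} hmn => by
          rw [smul_eq_mul, Ideal.mul_top, SModEq.sub_mem, ← Finsupp.sub_apply, ← map_sub]
          exact Basis.repr_mem_of_mem_map b _ (hy hmn) i
      refine ⟨l, fun n => ?_⟩
      have := hl n
      rwa [smul_eq_mul, Ideal.mul_top, SModEq.sub_mem] at this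
    choose l hl using hc
    refine ⟨∑ i, l i • b i, fun n => ?_⟩
    have h1 : x (e * n) - ∑ i, l i • b i ∈ J ^ n := by
      refine Ideal.pow_right_mono hIJ n ?_
      rw [← Ideal.map_pow]
      nth_rw 1 [← b.sum_repr (x (e * n))]
      rw [← Finset.sum_sub_distrib]
      refine sum_mem fun i _ => ?_
      rw [← sub_smul, Algebra.smul_def]
      exact Ideal.mul_mem_right _ _ (Ideal.mem_map_of_mem _ (hl i n))
    have h2 := hx (Nat.le_mul_of_pos_left n he)
    simpa using add_mem h2 h1

variable (p : ℕ) [Fact p.Prime] (L : Type*) [Field L] [Algebra ℚ_[p] L] [Algebra ℤ_[p] L]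
  [IsScalarTower ℤ_[p] ℚ_[p] L] [FiniteDimensional ℚ_[p] L]

instance isAdicComplete_intRing : IsAdicComplete (maxIdeal p L) (IntRing p L) where
  toIsHausdorff := by
    refine ⟨fun x hx => ?_⟩
    have h : x ∈ ⨅ i, maxIdeal p L ^ i := by
      rw [Ideal.mem_iInf]
      intro n
      have := hx n
      rwa [smul_eq_mul, Ideal.mul_top, SModEq.zero] at this
    rwa [Ideal.iInf_pow_eq_bot_of_isLocalRing _ (Ideal.IsPrime.ne_top inferInstance)] at h
  toIsPrecomplete := by
    obtain ⟨π, hπ⟩ := IsDiscreteValuationRing.exists_irreducible (IntRing p L)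
    have hm : (maximalIdeal ℤ_[p]).map (algebraMap ℤ_[p] (IntRing p L)) =
        maxIdeal p L ^ absRam p L := by
      rw [PadicInt.maximalIdeal_eq_span_p, Ideal.map_span, Set.image_singleton, map_natCast,
        maxIdeal, hπ.maximalIdeal_eq, Ideal.span_singleton_pow,
        Ideal.span_singleton_eq_span_singleton]
      exact associated_natCast_pow p L hπ
    refine isPrecomplete_of_free (maximalIdeal ℤ_[p]) _ ?_ (absRam_pos p L) hm.ge
    rw [hm]
    exact Ideal.pow_le_self (absRam_pos p L).ne'

end Completeness

/-! ### p-th powers of principal units. -/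

section PthPowersDVR

/-- The middle binomial coefficients are divisible by p, so their terms are absorbed into p·x. Only
p·x and x^p then compete for the leading term. -/
theorem exists_one_add_pow_prime_eq {R : Type*} [CommRing R] {p : ℕ} (hp : p.Prime) (x : R) :
    ∃ s, (1 + x) ^ p = 1 + p * x * (1 + x * s) + x ^ p := by
  obtain ⟨q, rfl⟩ := Nat.exists_eq_add_of_le' hp.two_le
  have h : ((q + 2 : ℕ) : R) * x ^ 2 ∣
      ∑ k ∈ Finset.range q, x ^ (k + 1 + 1) * ((q + 2).choose (k + 1 + 1) : R) := by
    refine Finset.dvd_sum fun k hk => ?_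
    obtain ⟨d, hd⟩ := hp.dvd_choose_self (k := k + 2) (by omega)
      (by have := Finset.mem_range.1 hk; omega)
    exact ⟨x ^ k * d, by rw [hd]; push_cast; ring⟩
  obtain ⟨s, hs⟩ := h
  refine ⟨s, ?_⟩
  rw [add_comm 1 x, add_pow]
  simp only [one_pow, mul_one]
  rw [Finset.sum_range_succ, Finset.sum_range_succ', Finset.sum_range_succ', hs]
  simp
  ring

variable {O : Type*} [CommRing O] [IsDomain O] [IsDiscreteValuationRing O] {p : ℕ} [Fact p.Prime]
  [CharP (ResidueField O) p] {π : O} (hπ : Irreducible π)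

include hπ in
theorem residue_eq_zero_iff_dvd (x : O) : residue O x = 0 ↔ π ∣ x := by
  rw [residue_eq_zero_iff, hπ.maximalIdeal_eq, Ideal.mem_span_singleton]

include hπ in
theorem isUnit_add_mul_uniformizer {u : O} (hu : IsUnit u) (x : O) : IsUnit (u + π * x) := by
  rw [← residue_ne_zero_iff_isUnit] at hu ⊢
  rwa [map_add, (residue_eq_zero_iff_dvd hπ (π * x)).2 (dvd_mul_right _ _), add_zero]

include hπ in
/-- An element whose `p`-th power is `1` in the residue field is itself `1` there. -/
theorem dvd_sub_one_of_dvd_pow_sub_one {v : O} (hv : π ∣ v ^ p - 1) : π ∣ v - 1 := by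
  rw [← residue_eq_zero_iff_dvd hπ] at hv ⊢
  rw [map_sub, map_pow, map_one, sub_eq_zero] at hv
  have : frobenius (ResidueField O) p (residue O v) = frobenius (ResidueField O) p 1 := by
    simpa [frobenius_def] using hv
  rw [map_sub, map_one, (frobenius (ResidueField O) p).injective this, sub_self]

include hπ in
theorem exists_eq_isUnit_mul_pow {x : O} (hx : x ≠ 0) : ∃ w a, IsUnit w ∧ x = w * π ^ a := by
  obtain ⟨n, u, h⟩ := IsDiscreteValuationRing.eq_unit_mul_pow_irreducible hx hπ
  exact ⟨u, n, u.isUnit, h⟩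

include hπ in
theorem le_of_pow_dvd_isUnit_mul_pow {u : O} (hu : IsUnit u) {m n : ℕ} (h : π ^ m ∣ u * π ^ n) :
    m ≤ n := by
  rw [hu.dvd_mul_left] at h
  exact (pow_dvd_pow_iff hπ.ne_zero hπ.not_isUnit).1 h

include hπ in
/-- The valuation of `v ^ p - 1` for `v` in the first unit group: nothing new appears in degrees
prime to `p` below `c * p`. -/
theorem pow_succ_dvd_pow_sub_one {c : ℕ} (hp : Associated (p : O) (π ^ (c * (p - 1))))
    {n : ℕ} (hn0 : 0 < n) (hn : n < c * p) (hpn : ¬ p ∣ n) {v : O} (hv : π ^ n ∣ v ^ p - 1) :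
    π ^ (n + 1) ∣ v ^ p - 1 := by
  have hpp : p.Prime := Fact.out
  obtain ⟨x, hx⟩ := dvd_sub_one_of_dvd_pow_sub_one (p := p) hπ
    ((dvd_pow_self π hn0.ne').trans hv)
  obtain rfl : v = 1 + π * x := by rw [← hx]; ring
  obtain ⟨ε, hε⟩ := hp.symm
  obtain ⟨s, hs⟩ := exists_one_add_pow_prime_eq hpp (π * x)
  have hcp : c * (p - 1) + c = c * p := by
    obtain ⟨q, rfl⟩ := Nat.exists_eq_add_of_le' hpp.one_le
    simp; ring
  by_cases h0 : x = 0
  · simp [h0]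
  obtain ⟨w, a, hw, rfl⟩ := exists_eq_isUnit_mul_pow hπ h0
  have hs' : (1 + π * (w * π ^ a)) ^ p - 1 =
      π ^ (c * (p - 1) + (a + 1)) * (ε * w * (1 + π * (w * π ^ a) * s)) +
        w ^ p * π ^ (p * (a + 1)) := by
    rw [hs, ← hε]
    ring
  -- Here v - 1 has valuation a + 1. If this is at least c, both terms have valuation at least cp >
  -- n. Otherwise x^p dominates and v^p - 1 has valuation exactly p(a + 1), which cannot equal n.
  by_cases hac : c ≤ a + 1
  · rw [hs']
    refine dvd_add (Dvd.dvd.mul_right (pow_dvd_pow π (by omega)) _)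
      (Dvd.dvd.mul_left (pow_dvd_pow π ?_) _)
    calc n + 1 ≤ c * p := hn
      _ = p * c := mul_comm _ _
      _ ≤ p * (a + 1) := Nat.mul_le_mul_left _ hac
  · obtain ⟨d, hd⟩ : ∃ d, c * (p - 1) + (a + 1) = p * (a + 1) + (d + 1) := by
      refine ⟨c * (p - 1) + (a + 1) - p * (a + 1) - 1, ?_⟩
      obtain ⟨q, hq⟩ := Nat.exists_eq_add_of_le' hpp.two_le
      obtain ⟨r, hr⟩ := Nat.exists_eq_add_of_lt (not_le.1 hac)
      have : p - 1 = q + 1 := by omega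
      rw [this, hq, hr]
      have : (a + 1 + r + 1) * (q + 1) + (a + 1) =
        (q + 2) * (a + 1) + ((r + 1) * q + r + 1) := by ring
      omega
    have hs2 : (1 + π * (w * π ^ a)) ^ p - 1 =
        (w ^ p + π * (π ^ d * (ε * w * (1 + π * (w * π ^ a) * s)))) * π ^ (p * (a + 1)) := by
      rw [hs', hd]
      ring
    rw [hs2] at hv ⊢
    have := le_of_pow_dvd_isUnit_mul_pow hπ (isUnit_add_mul_uniformizer hπ (hw.pow p) _) hv
    have h2 : n ≠ p * (a + 1) := fun h => hpn (h ▸ dvd_mul_right _ _)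
    exact Dvd.dvd.mul_left (pow_dvd_pow π (by omega)) _

include hπ in
/-- In degrees `p * j` with `j < c`, principal units are `p`-th powers to first order. -/
theorem exists_pow_congr_of_dvd [Finite (ResidueField O)] {c : ℕ}
    (hp : Associated (p : O) (π ^ (c * (p - 1)))) {j : ℕ} (hj : j < c) (y : O) :
    ∃ b, π ^ (p * j + 1) ∣ 1 + y * π ^ (p * j) - (1 + b * π ^ j) ^ p := by
  have hpp : p.Prime := Fact.out
  -- The finite residue field is perfect, so b can lift a p-th root of the residue of y. As j < c,
  -- the linear term of the p-th power has valuation above pj.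
  obtain ⟨b', hb'⟩ := (bijective_frobenius (ResidueField O) p).2 (residue O y)
  obtain ⟨b, rfl⟩ := residue_surjective b'
  obtain ⟨ε, hε⟩ := hp.symm
  obtain ⟨s, hs⟩ := exists_one_add_pow_prime_eq hpp (b * π ^ j)
  obtain ⟨d, hd⟩ : ∃ d, c * (p - 1) + j = p * j + (d + 1) := by
    refine ⟨c * (p - 1) + j - p * j - 1, ?_⟩
    obtain ⟨q, hq⟩ := Nat.exists_eq_add_of_le' hpp.two_le
    obtain ⟨r, hr⟩ := Nat.exists_eq_add_of_lt hj
    have : p - 1 = q + 1 := by omega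
    rw [this, hq, hr]
    have : (j + r + 1) * (q + 1) + j = (q + 2) * j + ((r + 1) * q + r + 1) := by ring
    omega
  have hy : π ∣ y - b ^ p := by
    rw [← residue_eq_zero_iff_dvd hπ, map_sub, map_pow, ← hb', frobenius_def, sub_self]
  obtain ⟨t, ht⟩ := hy
  refine ⟨b, t - π ^ d * (ε * b * (1 + b * π ^ j * s)), ?_⟩
  have h1 : (p : O) * (b * π ^ j) = π ^ (c * (p - 1) + j) * (ε * b) := by rw [← hε]; ring
  rw [hs, h1, hd, show y = b ^ p + π * t by rw [← ht]; ring]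
  ring

include hπ in
/-- A nontrivial `p`-th root of unity forces `p - 1` to divide the absolute ramification index. -/
theorem exists_eq_mul_of_pow_eq_one {E : ℕ} (hp : Associated (p : O) (π ^ E)) {v : O}
    (hv : v ^ p = 1) (hv1 : v ≠ 1) : ∃ c, E = c * (p - 1) := by
  have hpp : p.Prime := Fact.out
  obtain ⟨x, hx⟩ := dvd_sub_one_of_dvd_pow_sub_one (p := p) hπ
    (show π ∣ v ^ p - 1 by rw [hv, sub_self]; exact dvd_zero _)
  obtain rfl : v = 1 + π * x := by rw [← hx]; ring
  obtain ⟨s, hs⟩ := exists_one_add_pow_prime_eq hpp (π * x)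
  have h0 : x ≠ 0 := by
    rintro rfl
    simp at hv1
  obtain ⟨w, a, hw, rfl⟩ := exists_eq_isUnit_mul_pow hπ h0
  obtain ⟨ε, hε⟩ := hp.symm
  -- The two competing terms must cancel, so E + (a + 1) = p(a + 1). Thus c is the valuation a + 1
  -- of v - 1.
  have hs1 : -(ε * w * (1 + π * (w * π ^ a * s))) * π ^ (E + (a + 1)) =
      w ^ p * π ^ (p * (a + 1)) := by
    rw [hv, ← hε] at hs
    linear_combination hs
  have hu1 : IsUnit (-(ε * w * (1 + π * (w * π ^ a * s)))) :=
    ((ε.isUnit.mul hw).mul (isUnit_add_mul_uniformizer hπ isUnit_one _)).neg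
  have h1 := le_of_pow_dvd_isUnit_mul_pow hπ (hw.pow p) (hs1 ▸ dvd_mul_left _ _)
  have h2 := le_of_pow_dvd_isUnit_mul_pow hπ hu1 (hs1.symm ▸ dvd_mul_left _ _)
  refine ⟨a + 1, ?_⟩
  obtain ⟨q, rfl⟩ := Nat.exists_eq_add_of_le' hpp.one_le
  have : (q + 1) * (a + 1) = (a + 1) * q + (a + 1) := by ring
  simp only [Nat.add_sub_cancel]
  omega

open Polynomial in
include hπ in
/-- Hensel's lemma for `(1 + π ^ c * x) ^ p = 1 + π ^ (c * p) * y`. -/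
theorem exists_pow_eq_of_residue [IsAdicComplete (maximalIdeal O) O] {c : ℕ} (hc : 0 < c) {ε : O}
    (hε : IsUnit ε) (hp : (p : O) = ε * π ^ (c * (p - 1))) (y a : O)
    (ha : π ∣ a ^ p + ε * a - y) :
    ∃ x, π ∣ x - a ∧ (1 + π ^ c * x) ^ p = 1 + π ^ (c * p) * y := by
  have hpp : p.Prime := Fact.out
  have hcp : c * (p - 1) + c = c * p := by
    obtain ⟨q, rfl⟩ := Nat.exists_eq_add_of_le' hpp.one_le
    simp; ring
  have hπ0 : π ^ (c * p) ≠ 0 := pow_ne_zero _ hπ.ne_zero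
  have hcoeff : ∀ k, ((C (π ^ c) * X + 1 : O[X]) ^ p).coeff k = π ^ (c * k) * p.choose k := by
    intro k
    have : (C (π ^ c) * X + 1 : O[X]) ^ p = ((X + 1) ^ p : O[X]).comp (C (π ^ c) * X) := by simp
    rw [this, comp_C_mul_X_coeff, coeff_X_add_one_pow, ← pow_mul, mul_comm]
  -- After division by π^(cp) the equation becomes a monic g congruent to X^p + εX - y modulo π. Its
  -- derivative ε(1 + π^c X)^(p-1) takes unit values, so simple roots lift.
  obtain ⟨g, hg⟩ : C (π ^ (c * p)) ∣ (C (π ^ c) * X + 1 : O[X]) ^ p - C (1 + π ^ (c * p) * y) := by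
    rw [C_dvd_iff_dvd_coeff]
    intro k
    rw [coeff_sub, hcoeff, coeff_C]
    rcases Nat.eq_zero_or_pos k with rfl | hk
    · simp
    rw [if_neg hk.ne', sub_zero]
    rcases lt_trichotomy k p with hkp | rfl | hkp
    · obtain ⟨d, hd⟩ := hpp.dvd_choose_self hk.ne' hkp
      rw [hd, Nat.cast_mul, hp, ← hcp]
      have : π ^ (c * k) = π ^ c * π ^ (c * (k - 1)) := by
        rw [← pow_add]
        congr 1
        obtain ⟨q, rfl⟩ := Nat.exists_eq_add_of_le' hk
        simp; ring
      rw [this, pow_add]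
      exact ⟨ε * π ^ (c * (k - 1)) * d, by ring⟩
    · exact Dvd.dvd.mul_right dvd_rfl _
    · simp [Nat.choose_eq_zero_of_lt hkp]
  have hev : ∀ b, π ^ (c * p) * g.eval b = (1 + π ^ c * b) ^ p - (1 + π ^ (c * p) * y) := by
    intro b
    have := congrArg (eval b) hg
    simp at this
    rw [← this]
    ring
  have hder : ∀ b, g.derivative.eval b = ε * (1 + π ^ c * b) ^ (p - 1) := by
    intro b
    have := congrArg (fun q => eval b (derivative q)) hg
    simp [derivative_pow] at this
    apply mul_left_cancel₀ hπ0
    rw [← this, hp, ← hcp, pow_add]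
    ring
  have hcoeffg : ∀ k, π ^ (c * p) * g.coeff k = π ^ (c * k) * p.choose k -
      (C (1 + π ^ (c * p) * y) : O[X]).coeff k := by
    intro k
    rw [← hcoeff, ← coeff_sub, hg, coeff_C_mul]
  have hmonic : g.Monic := by
    refine monic_of_natDegree_le_of_coeff_eq_one p ?_ ?_
    · rw [natDegree_le_iff_coeff_eq_zero]
      intro k hk
      apply mul_left_cancel₀ hπ0
      rw [hcoeffg, Nat.choose_eq_zero_of_lt hk, coeff_C, if_neg (by omega)]
      simp
    · apply mul_left_cancel₀ hπ0
      rw [hcoeffg, coeff_C, if_neg hpp.ne_zero]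
      simp
  have h1 : g.eval a ∈ maximalIdeal O := by
    rw [hπ.maximalIdeal_eq, Ideal.mem_span_singleton]
    obtain ⟨s, hs⟩ := exists_one_add_pow_prime_eq hpp (π ^ c * a)
    have : g.eval a = a ^ p + ε * a - y + π ^ c * (ε * a * a * s) := by
      apply mul_left_cancel₀ hπ0
      rw [hev, hs, hp, ← hcp, pow_add, mul_pow, ← pow_mul, ← hcp, pow_add]
      ring
    rw [this]
    exact dvd_add ha (Dvd.dvd.mul_right (dvd_pow_self π hc.ne') _)
  have h2 : IsUnit (Ideal.Quotient.mk (maximalIdeal O) (g.derivative.eval a)) := by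
    rw [hder]
    refine IsUnit.map _ (hε.mul (IsUnit.pow _ ?_))
    obtain ⟨d, rfl⟩ := Nat.exists_eq_add_of_le' hc
    have := isUnit_add_mul_uniformizer hπ isUnit_one (π ^ d * a)
    rwa [← mul_assoc, ← pow_succ'] at this
  obtain ⟨x, hx, hxa⟩ := HenselianRing.is_henselian g hmonic a h1 h2
  refine ⟨x, ?_, ?_⟩
  · rwa [hπ.maximalIdeal_eq, Ideal.mem_span_singleton] at hxa
  · have := hev x
    rw [hx.eq_zero, mul_zero] at this
    exact (sub_eq_zero.1 this.symm)

include hπ in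
/-- If `O` has no nontrivial `p`-th root of unity, the units of level `c * p` are `p`-th powers. -/
theorem exists_pow_eq_of_level [IsAdicComplete (maximalIdeal O) O] [Finite (ResidueField O)]
    {c : ℕ} (hc : 0 < c) (hp : Associated (p : O) (π ^ (c * (p - 1))))
    (hroot : ∀ v : O, v ^ p = 1 → v = 1) (y : O) :
    ∃ x, (1 + π ^ c * x) ^ p = 1 + π ^ (c * p) * y := by
  obtain ⟨ε, hε⟩ := hp.symm
  have hp' : (p : O) = ε * π ^ (c * (p - 1)) := by rw [← hε, mul_comm]
  -- In level cp, taking p-th powers induces a ↦ a^p + εa on the residue field. A nonzero kernel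
  -- element would lift to a nontrivial p-th root of unity, so this map is injective, hence
  -- surjective by finiteness.
  let φ : ResidueField O →+ ResidueField O :=
    (frobenius (ResidueField O) p : ResidueField O →+ ResidueField O) +
      AddMonoidHom.mulLeft (residue O ε)
  have hφ : ∀ a, φ (residue O a) = residue O (a ^ p + ε * a) := fun a => by
    simp [φ, frobenius_def]
  have hinj : Function.Injective φ := by
    rw [injective_iff_map_eq_zero]
    intro a ha
    obtain ⟨a, rfl⟩ := residue_surjective a
    rw [hφ, residue_eq_zero_iff_dvd hπ, ← sub_zero (_ + _)] at ha
    obtain ⟨x, hxa, hx⟩ := exists_pow_eq_of_residue hπ hc ε.isUnit hp' 0 a ha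
    have h1 := hroot (1 + π ^ c * x) (by rw [hx]; ring)
    have hx0 : x = 0 := by
      have : π ^ c * x = 0 := by linear_combination h1
      exact (mul_eq_zero.1 this).resolve_left (pow_ne_zero _ hπ.ne_zero)
    rw [hx0, zero_sub, dvd_neg] at hxa
    rwa [residue_eq_zero_iff_dvd hπ]
  obtain ⟨a, ha⟩ := (Finite.injective_iff_surjective.1 hinj) (residue O y)
  obtain ⟨a, rfl⟩ := residue_surjective a
  rw [hφ, ← sub_eq_zero, ← map_sub, residue_eq_zero_iff_dvd hπ] at ha
  obtain ⟨x, -, hx⟩ := exists_pow_eq_of_residue hπ hc ε.isUnit hp' y a ha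
  exact ⟨x, hx⟩

end PthPowersDVR

/-! ### Splitting of filtrations and scalar extension. -/

section ModuleLemmas

variable {R : Type*} [Ring R]

/-- A surjection of `N` onto a projective module splits `N` as the product with the kernel. -/
theorem nonempty_equiv_prod_of_surjective {N V X : Type*} [AddCommGroup N] [Module R N]
    [AddCommGroup V] [Module R V] [Module.Projective R V] [AddCommGroup X] [Module R X]
    (f : N →ₗ[R] V) (hf : Function.Surjective f) (e : LinearMap.ker f ≃ₗ[R] X) :
    Nonempty (N ≃ₗ[R] V × X) := by
  obtain ⟨g, hg⟩ := Module.projective_lifting_property f LinearMap.id hf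
  have hg' : ∀ v, f (g v) = v := fun v => LinearMap.congr_fun hg v
  let h : V × LinearMap.ker f →ₗ[R] N := g.coprod (LinearMap.ker f).subtype
  have hinj : Function.Injective h := by
    rw [injective_iff_map_eq_zero]
    rintro ⟨v, k⟩ hvk
    have h1 : g v + k = 0 := hvk
    have h2 : v = 0 := by
      have := congrArg f h1
      rwa [map_add, hg', k.2, add_zero, map_zero] at this
    subst h2
    rw [map_zero, zero_add] at h1
    exact Prod.ext rfl (Subtype.ext h1)
  have hsurj : Function.Surjective h := fun x =>
    ⟨(f x, ⟨x - g (f x), by rw [LinearMap.mem_ker, map_sub, hg', sub_self]⟩), by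
      change g (f x) + (x - g (f x)) = x
      abel⟩
  exact ⟨(LinearEquiv.ofBijective h ⟨hinj, hsurj⟩).symm.trans
    (LinearEquiv.prodCongr (LinearEquiv.refl R V) e)⟩

/-- Splitting off one factor of a product indexed by a subtype. -/
theorem nonempty_prod_equiv_pi {ι : Type*} (V : ι → Type*) [∀ i, AddCommGroup (V i)]
    [∀ i, Module R (V i)] {P Q : ι → Prop} (a : ι) (ha : ¬ Q a) (hPQ : ∀ i, P i ↔ i = a ∨ Q i) :
    Nonempty ((V a × ∀ i : {i // Q i}, V i) ≃ₗ[R] ∀ i : {i // P i}, V i) := by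
  let r : (∀ i : {i // P i}, V i) →ₗ[R] V a × ∀ i : {i // Q i}, V i :=
    (LinearMap.proj (⟨a, (hPQ a).2 (.inl rfl)⟩ : {i // P i})).prod
      (LinearMap.pi fun i : {i // Q i} => LinearMap.proj (⟨i, (hPQ i).2 (.inr i.2)⟩ : {i // P i}))
  refine ⟨(LinearEquiv.ofBijective r ⟨?_, ?_⟩).symm⟩
  · intro x y hxy
    funext ⟨i, hi⟩
    rcases (hPQ i).1 hi with rfl | hq
    · exact congrArg Prod.fst hxy
    · exact congrFun (congrArg Prod.snd hxy) ⟨i, hq⟩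
  · classical
    rintro ⟨v, w⟩
    refine ⟨fun i => if h : (i : ι) = a then h.symm ▸ v else
      w ⟨i, ((hPQ i).1 i.2).resolve_left h⟩, Prod.ext ?_ (funext fun i => ?_)⟩
    · simp [r]
    · have : (i : ι) ≠ a := fun h => ha (h ▸ i.2)
      simp [r, this]

/-- A finite filtration whose nonzero graded pieces are projective modules `V i` splits. -/
theorem nonempty_equiv_pi_of_filtration {X : Type*} [AddCommGroup X] [Module R X]
    (V : ℕ → Type*) [∀ i, AddCommGroup (V i)] [∀ i, Module R (V i)]
    [∀ i, Module.Projective R (V i)] (N : ℕ → Submodule R X) (b : ℕ) (P : ℕ → Prop)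
    (hb : N b = ⊥) (hle : ∀ n, N (n + 1) ≤ N n)
    (hskip : ∀ n, 0 < n → n < b → ¬ P n → N n ≤ N (n + 1))
    (hgr : ∀ n, 0 < n → n < b → P n → ∃ f : N n →ₗ[R] V n, Function.Surjective f ∧
      ∀ x, f x = 0 ↔ (x : X) ∈ N (n + 1)) (hb0 : 0 < b) :
    Nonempty (N 1 ≃ₗ[R] ∀ i : {i // 1 ≤ i ∧ i < b ∧ P i}, V i) := by
  -- The induction is on b - m, starting from N b = 0. Each degree satisfying P splits off one
  -- projective quotient.
  suffices h : ∀ d m, 0 < m → m + d = b →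
      Nonempty (N m ≃ₗ[R] ∀ i : {i // m ≤ i ∧ i < b ∧ P i}, V i) from
    h (b - 1) 1 one_pos (by omega)
  intro d
  induction d with
  | zero =>
    rintro m - rfl
    have h1 : IsEmpty {i // m ≤ i ∧ i < m + 0 ∧ P i} := ⟨fun i => by
      have := i.2; omega⟩
    have h2 : Subsingleton (N m) := by
      rw [add_zero] at hb
      rw [hb]
      infer_instance
    exact ⟨0, 0, fun _ => Subsingleton.elim _ _, fun _ => Subsingleton.elim _ _⟩
  | succ d ih =>
    intro m hm hmd
    obtain ⟨E⟩ := ih (m + 1) (by omega) (by omega)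
    by_cases hP : P m
    · obtain ⟨f, hf, hker⟩ := hgr m hm (by omega) hP
      have hk : LinearMap.ker f = (N (m + 1)).submoduleOf (N m) := by
        ext x
        rw [LinearMap.mem_ker, hker]
        rfl
      obtain ⟨E1⟩ := nonempty_equiv_prod_of_surjective f hf
        ((LinearEquiv.ofEq _ _ hk).trans ((Submodule.submoduleOfEquivOfLe (hle m)).trans E))
      obtain ⟨E2⟩ := nonempty_prod_equiv_pi (R := R) V
        (P := fun i => m ≤ i ∧ i < b ∧ P i) (Q := fun i => m + 1 ≤ i ∧ i < b ∧ P i) m (by omega)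
        (fun i => by
          constructor
          · rintro ⟨h1, h2, h3⟩
            rcases h1.eq_or_lt with rfl | h
            · exact .inl rfl
            · exact .inr ⟨h, h2, h3⟩
          · rintro (rfl | ⟨h1, h2, h3⟩)
            · exact ⟨le_rfl, by omega, hP⟩
            · exact ⟨by omega, h2, h3⟩)
      exact ⟨E1.trans E2⟩
    · have hN : N m = N (m + 1) := le_antisymm (hskip m hm (by omega) hP) (hle m)
      have hI : ∀ i, (m + 1 ≤ i ∧ i < b ∧ P i) ↔ (m ≤ i ∧ i < b ∧ P i) := fun i => by
        constructor
        · rintro ⟨h1, h2⟩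
          exact ⟨by omega, h2⟩
        · rintro ⟨h1, h2, h3⟩
          refine ⟨lt_of_le_of_ne h1 ?_, h2, h3⟩
          rintro rfl
          exact hP h3
      let σ : {i // m + 1 ≤ i ∧ i < b ∧ P i} ≃ {i // m ≤ i ∧ i < b ∧ P i} :=
        Equiv.subtypeEquivRight hI
      exact ⟨(LinearEquiv.ofEq _ _ hN).trans
        (E.trans (LinearEquiv.piCongrLeft R (fun i : {i // m ≤ i ∧ i < b ∧ P i} => V i) σ))⟩

/-- Extension of scalars of a free module is free. -/
theorem nonempty_scalarExt_equiv {S M : Type*} [Ring S] [AddCommGroup M] [Module R M]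
    (f : R →+* S) (n : ℕ) (E : M ≃ₗ[R] (Fin n → R)) :
    Nonempty (ScalarExt f M ≃ₗ[S] (Fin n → S)) := by
  -- The scalars f(r) multiply on the right, so left S-linearity survives although S need not be
  -- commutative.
  let φ : (TensorProduct ℤ S M) →ₗ[S] (Fin n → S) :=
    TensorProduct.AlgebraTensorModule.lift
      { toFun := fun s =>
          ({ toFun := fun m i => s * f (E m i)
             map_zero' := by ext; simp
             map_add' := fun x y => by ext; simp [mul_add] } : M →+ (Fin n → S)).toIntLinearMap
        map_add' := fun x y => by ext; simp [add_mul]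
        map_smul' := fun x y => by ext; simp [mul_assoc] }
  have hφ : ∀ s m, φ (s ⊗ₜ m) = fun i => s * f (E m i) := fun s m => rfl
  have hrel : balancedRel f M ≤ LinearMap.ker φ := by
    rw [balancedRel, Submodule.span_le]
    rintro _ ⟨s, r, m, rfl⟩
    rw [SetLike.mem_coe, LinearMap.mem_ker, map_sub, hφ, hφ]
    ext i
    simp [mul_assoc]
  let Φ : ScalarExt f M →ₗ[S] (Fin n → S) := (balancedRel f M).liftQ φ hrel
  let e : Fin n → M := fun i => E.symm (Pi.single i 1)
  let Ψ : (Fin n → S) →ₗ[S] ScalarExt f M :=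
    { toFun := fun v => ∑ i, Submodule.Quotient.mk (v i ⊗ₜ[ℤ] e i)
      map_add' := fun v w => by
        simp [TensorProduct.add_tmul, Finset.sum_add_distrib]
      map_smul' := fun s v => by
        simp [Finset.smul_sum, ← Submodule.Quotient.mk_smul, TensorProduct.smul_tmul'] }
  refine ⟨LinearEquiv.ofLinearMap Φ Ψ ?_ ?_⟩
  · refine LinearMap.ext fun v => ?_
    change Φ (∑ i, Submodule.Quotient.mk (v i ⊗ₜ[ℤ] e i)) = v
    rw [map_sum]
    ext j
    have h : ∀ i, Φ (Submodule.Quotient.mk (v i ⊗ₜ[ℤ] e i)) = fun j => v i * f (E (e i) j) :=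
      fun i => hφ (v i) (e i)
    simp [h, e, Finset.sum_apply, Pi.single_apply, apply_ite f]
  · refine Submodule.linearMap_qext _ (TensorProduct.AlgebraTensorModule.ext fun s m => ?_)
    change ∑ i, Submodule.Quotient.mk ((φ (s ⊗ₜ m) i) ⊗ₜ[ℤ] e i) =
      (Submodule.Quotient.mk (s ⊗ₜ m) : ScalarExt f M)
    have h : ∀ i, (Submodule.Quotient.mk ((s * f (E m i)) ⊗ₜ[ℤ] e i) : ScalarExt f M) =
        Submodule.Quotient.mk (s ⊗ₜ[ℤ] (E m i • e i)) := fun i => by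
      rw [Submodule.Quotient.eq]
      exact Submodule.subset_span ⟨s, E m i, e i, rfl⟩
    have hm : m = ∑ i, E m i • e i := by
      apply E.injective
      ext j
      simp [e, Finset.sum_apply, Pi.single_apply]
    simp only [hφ, h]
    conv_rhs => rw [hm, TensorProduct.tmul_sum]
    exact (map_sum (balancedRel f M).mkQ _ _).symm

end ModuleLemmas

/-! ### Modules over F_p[G]. -/

section GroupAlgebra

variable {p : ℕ} [Fact p.Prime] {G : Type*} [Group G]

/-- An equivariant additive map between `𝔽_p[G]`-modules is linear. -/
def linearMapOfEquivariant {M N : Type*} [AddCommGroup M] [Module (MonoidAlgebra (ZMod p) G) M]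
    [AddCommGroup N] [Module (MonoidAlgebra (ZMod p) G) N] (f : M →+ N)
    (hf : ∀ (g : G) (x : M), f (MonoidAlgebra.single g (1 : ZMod p) • x) =
      MonoidAlgebra.single g (1 : ZMod p) • f x) : M →ₗ[MonoidAlgebra (ZMod p) G] N where
  __ := f
  map_smul' a x := by
    change f (a • x) = a • f x
    induction a using MonoidAlgebra.induction_linear with
    | zero => simp
    | add a b ha hb => rw [add_smul, add_smul, map_add, ha, hb]
    | single g c =>
      -- Coefficients in F_p are natural multiples of 1, so additivity already gives linearity over
      -- them.
      have : MonoidAlgebra.single g c = c.val • MonoidAlgebra.single g (1 : ZMod p) := by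
        rw [MonoidAlgebra.smul_single, nsmul_one, ZMod.natCast_zmod_val]
      rw [this, smul_assoc, smul_assoc, map_nsmul, hf]

/-- A coefficient field `k` of degree `n` over `𝔽_p` makes `k[G]` free of rank `n` over
`𝔽_p[G]`. -/
theorem nonempty_monoidAlgebra_equiv {k : Type*} [Field k] [Algebra (ZMod p) k] [Finite k] {n : ℕ}
    (hn : Nat.card k = p ^ n) [Module (MonoidAlgebra (ZMod p) G) (MonoidAlgebra k G)]
    (hsmul : ∀ (g : G) (a : MonoidAlgebra k G), MonoidAlgebra.single g (1 : ZMod p) • a =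
      MonoidAlgebra.single g (1 : k) * a) [Finite G] :
    Nonempty (MonoidAlgebra k G ≃ₗ[MonoidAlgebra (ZMod p) G]
      (Fin n → MonoidAlgebra (ZMod p) G)) := by
  have hpp : p.Prime := Fact.out
  have hfr : finrank (ZMod p) k = n := by
    have := Module.natCard_eq_pow_finrank (K := ZMod p) (V := k)
    rw [Nat.card_zmod, hn] at this
    exact (Nat.pow_right_injective hpp.two_le this).symm
  let b := Module.finBasisOfFinrankEq (ZMod p) k hfr
  let Φ : MonoidAlgebra k G ≃+ (Fin n → MonoidAlgebra (ZMod p) G) :=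
    { toFun := fun a i => .ofCoeff (Finsupp.equivFunOnFinite.symm fun g => b.repr (a.coeff g) i)
      invFun := fun v => .ofCoeff (Finsupp.equivFunOnFinite.symm fun g =>
        b.equivFun.symm fun i => (v i).coeff g)
      left_inv := fun a => by
        ext g
        exact b.equivFun.symm_apply_apply (a.coeff g)
      right_inv := fun v => by
        ext i g
        exact congrFun (b.equivFun.apply_symm_apply fun i => (v i).coeff g) i
      map_add' := fun a a' => by
        ext i g
        simp }
  have hΦ : ∀ (g : G) (a : MonoidAlgebra k G), Φ.toAddMonoidHom (MonoidAlgebra.single g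
      (1 : ZMod p) • a) = MonoidAlgebra.single g (1 : ZMod p) • Φ.toAddMonoidHom a := fun g a => by
    ext i h
    simp [Φ, hsmul]
  exact ⟨LinearEquiv.ofBijective (linearMapOfEquivariant Φ.toAddMonoidHom hΦ) Φ.bijective⟩

end GroupAlgebra

/-! ### Semilinear twists of the residue field. -/

section Twist

variable (p : ℕ) [Fact p.Prime] {G : Type*} [Group G] {l : Type*} [Field l] [CharP l p]
  [MulSemiringAction G l]

/-- A function `G → l` satisfying the multiplicative cocycle identity. -/
structure IsCocycle (χ : G → l) : Prop where
  map_one : χ 1 = 1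
  map_mul : ∀ g h, χ (g * h) = χ g * g • χ h

theorem IsCocycle.ne_zero {χ : G → l} (hχ : IsCocycle χ) (g : G) : χ g ≠ 0 := fun h => by
  have := hχ.map_mul g g⁻¹
  rw [mul_inv_cancel, hχ.map_one, h, zero_mul] at this
  exact one_ne_zero this

/-- The semilinear representation on `l` twisted by the `n`-th power of a cocycle. -/
def twistRep [Algebra (ZMod p) l] {χ : G → l} (hχ : IsCocycle χ) (n : ℕ) :
    Representation (ZMod p) G l where
  toFun g := ((AddMonoidHom.mulLeft (χ g ^ n)).comp
    (DistribSMul.toAddMonoidHom l g)).toZModLinearMap p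
  map_one' := by
    ext x
    simp [hχ.map_one]
  map_mul' g h := by
    ext x
    simp [hχ.map_mul, mul_pow, mul_smul, smul_mul', smul_pow', mul_assoc]

/-- The underlying module of `twistRep`. -/
def Twist {χ : G → l} (_hχ : IsCocycle χ) (_n : ℕ) : Type _ := l

variable {χ : G → l} (hχ : IsCocycle χ) (n : ℕ)

instance : AddCommGroup (Twist hχ n) := inferInstanceAs (AddCommGroup l)

instance [Finite l] : Finite (Twist hχ n) := inferInstanceAs (Finite l)

variable [Algebra (ZMod p) l]

instance : Module (MonoidAlgebra (ZMod p) G) (Twist hχ n) :=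
  Module.compHom l (twistRep p hχ n).asAlgebraHom.toRingHom

/-- The tautological identification of `l` with its twist. -/
def Twist.of : l ≃+ Twist hχ n := AddEquiv.refl l

theorem single_smul_twist_of (g : G) (x : l) :
    MonoidAlgebra.single g (1 : ZMod p) • Twist.of hχ n x =
      Twist.of hχ n (χ g ^ n * g • x) := by
  change (twistRep p hχ n).asAlgebraHom (MonoidAlgebra.single g 1) x = _
  rw [Representation.asAlgebraHom_single, one_smul]
  rfl

/-- The isomorphism is Frobenius: it commutes with G and raises the twisting factor χ^n to its p-th
power. It is only F_p-linear, which is why the modules are taken over F_p[G]. -/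
theorem nonempty_twist_mul_equiv [Finite l] :
    Nonempty (Twist hχ n ≃ₗ[MonoidAlgebra (ZMod p) G] Twist hχ (p * n)) := by
  let F : Twist hχ n →+ Twist hχ (p * n) := ((Twist.of hχ (p * n)).toAddMonoidHom.comp
    (frobenius l p : l →+ l)).comp (Twist.of hχ n).symm.toAddMonoidHom
  have hF : ∀ x : l, F (Twist.of hχ n x) = Twist.of hχ (p * n) (x ^ p) := fun x => rfl
  have h : ∀ (g : G) (x : Twist hχ n), F (MonoidAlgebra.single g (1 : ZMod p) • x) =
      MonoidAlgebra.single g (1 : ZMod p) • F x := fun g x => by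
    obtain ⟨x, rfl⟩ := (Twist.of hχ n).surjective x
    rw [single_smul_twist_of, hF, hF, single_smul_twist_of, smul_pow', mul_pow, ← pow_mul,
      mul_comm n p]
  exact ⟨LinearEquiv.ofBijective (linearMapOfEquivariant F h) (bijective_frobenius l p)⟩

theorem nonempty_twist_pow_mul_equiv [Finite l] (u : ℕ) :
    Nonempty (Twist hχ n ≃ₗ[MonoidAlgebra (ZMod p) G] Twist hχ (p ^ u * n)) := by
  induction u with
  | zero => exact ⟨LinearEquiv.cast (R := MonoidAlgebra (ZMod p) G) (M := Twist hχ) (by simp)⟩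
  | succ u ih =>
    obtain ⟨E⟩ := ih
    obtain ⟨E'⟩ := nonempty_twist_mul_equiv p hχ (p ^ u * n)
    rw [pow_succ', mul_assoc]
    exact ⟨E.trans E'⟩

/-- The sum of `e` consecutive twists of `l` is isomorphic to `k[G]`, when the inertia group `T`,
of order `e`, acts trivially on `l` and faithfully through the cocycle, and the quotient by `T`
lifts to a subgroup on which the cocycle is trivial. -/
theorem nonempty_twist_block_equiv [Finite G] [Finite l] {k : Type*} [Field k] [Algebra k l]
    [SMulCommClass G k l] [Module (MonoidAlgebra (ZMod p) G) (MonoidAlgebra k G)]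
    (hsmul : ∀ (g : G) (a : MonoidAlgebra k G), MonoidAlgebra.single g (1 : ZMod p) • a =
      MonoidAlgebra.single g (1 : k) * a)
    (T : Subgroup G) [T.Normal] (hT : ∀ g, g ∈ T ↔ ∀ x : l, g • x = x)
    (hTχ : ∀ t ∈ T, χ t = 1 → t = 1) (s : G ⧸ T →* G) (hs : ∀ q, QuotientGroup.mk' T (s q) = q)
    (hsχ : ∀ q, χ (s q) = 1) {e f : ℕ} (he : Nat.card T = e) (hG : Nat.card G = e * f)
    (hl : Nat.card l = Nat.card k ^ f) :
    Nonempty ((∀ j : Fin e, Twist hχ (n + j)) ≃ₗ[MonoidAlgebra (ZMod p) G]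
      MonoidAlgebra k G) := by
  classical
  have := Fintype.ofFinite G
  have : Finite k := Finite.of_injective _ (algebraMap k l).injective
  obtain ⟨θ, hθ⟩ := exists_linearIndependent_algEquiv_apply k l
  -- The conjugates of θ over k are linearly independent. Φ is the equivariant map sending the
  -- generator 1 of k[G] to (θ, …, θ).
  let Φ : MonoidAlgebra k G →+ ∀ j : Fin e, Twist hχ (n + j) :=
    { toFun := fun a j => Twist.of hχ (n + j)
        (∑ g, algebraMap k l (a.coeff g) * (χ g ^ (n + j : ℕ) * g • θ))
      map_zero' := by
        funext j
        simp
      map_add' := fun a b => by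
        funext j
        simp [add_mul, Finset.sum_add_distrib] }
  have hΦ : ∀ a j, Φ a j = Twist.of hχ (n + j)
      (∑ g, algebraMap k l (a.coeff g) * (χ g ^ (n + j : ℕ) * g • θ)) := fun a j => rfl
  have hequiv : ∀ (g : G) (a : MonoidAlgebra k G), Φ (MonoidAlgebra.single g (1 : ZMod p) • a) =
      MonoidAlgebra.single g (1 : ZMod p) • Φ a := fun g a => by
    funext j
    rw [Pi.smul_apply, hΦ, hΦ, single_smul_twist_of, hsmul, Finset.smul_sum, Finset.mul_sum]
    congr 1
    refine Fintype.sum_equiv (Equiv.mulLeft g⁻¹) _ _ fun h => ?_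
    obtain ⟨h, rfl⟩ : ∃ h', h = g * h' := ⟨g⁻¹ * h, by simp⟩
    have hc : (MonoidAlgebra.single g (1 : k) * a).coeff (g * h) = a.coeff h := by
      simp
    rw [hc, show Equiv.mulLeft g⁻¹ (g * h) = h from inv_mul_cancel_left g h,
      hχ.map_mul, smul_mul', smul_algebraMap, smul_mul', smul_pow', mul_pow, mul_smul]
    ring
  have hinj : Function.Injective Φ := by
    rw [injective_iff_map_eq_zero]
    intro a ha
    let σ : T × (G ⧸ T) ≃ G := Equiv.ofBijective (fun x => x.1 * s x.2) ⟨by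
      rintro ⟨t, q⟩ ⟨t', q'⟩ (h : (t : G) * s q = t' * s q')
      have h1 : ∀ (t : T) q, QuotientGroup.mk' T (t * s q) = q := fun t q => by
        rw [_root_.map_mul, hs, QuotientGroup.mk'_apply, (QuotientGroup.eq_one_iff _).2 t.2,
          one_mul]
      obtain rfl : q = q' := by rw [← h1 t q, h, h1]
      exact Prod.ext (Subtype.ext (mul_right_cancel h)) rfl, fun g => by
      refine ⟨(⟨g * (s (QuotientGroup.mk' T g))⁻¹, ?_⟩, QuotientGroup.mk' T g), ?_⟩
      · rw [← QuotientGroup.eq_one_iff, ← QuotientGroup.mk'_apply, _root_.map_mul, map_inv, hs,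
          mul_inv_cancel]
      · exact inv_mul_cancel_right _ _⟩
    have := Fintype.ofFinite T
    have := Fintype.ofFinite (G ⧸ T)
    -- Since G = T·s(G/T), T acts trivially on l and χ(t·s(q)) = χ(t), the equation Φ a = 0 becomes
    -- a linear system in the B t. Its matrix is Vandermonde up to the nonzero factors χ(t)^n, with
    -- nodes χ(t) that are distinct because χ is faithful on T.
    let B : T → l := fun t => ∑ q, algebraMap k l (a.coeff (t * s q)) * s q • θ
    have hχσ : ∀ (t : T) q, χ (t * s q) = χ t := fun t q => by
      rw [hχ.map_mul, hsχ, smul_one, mul_one]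
    have hsum : ∀ j : Fin e, ∑ t : T, χ t ^ (n + j : ℕ) * B t = 0 := fun j => by
      have h0 : Φ a j = 0 := congrFun ha j
      rw [hΦ, EmbeddingLike.map_eq_zero_iff,
        ← Fintype.sum_equiv σ (fun x => algebraMap k l (a.coeff (σ x)) *
        (χ (σ x) ^ (n + j : ℕ) * σ x • θ)) _ fun x => rfl, Fintype.sum_prod_type] at h0
      rw [← h0]
      refine Finset.sum_congr rfl fun t _ => ?_
      rw [Finset.mul_sum]
      refine Finset.sum_congr rfl fun q _ => ?_
      change _ = algebraMap k l (a.coeff (t * s q)) * (χ (t * s q) ^ (n + j : ℕ) * (t * s q) • θ)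
      rw [hχσ, mul_smul, (hT t).1 t.2]
      ring
    have hB : ∀ t, B t = 0 := by
      let τ : Fin e ≃ T := (Finite.equivFinOfCardEq he).symm
      have hv := Matrix.eq_zero_of_forall_pow_sum_mul_pow_eq_zero
        (f := fun i => χ (τ i)) (v := fun i => χ (τ i) ^ n * B (τ i)) ?_ ?_
      · intro t
        have := congrFun hv (τ.symm t)
        simpa [hχ.ne_zero] using this
      · intro i j hij
        have h1 := hχ.map_mul (τ j) ((τ j : G)⁻¹ * τ i)
        rw [mul_inv_cancel_left, (hT _).1 (τ j).2, ← mul_one (χ (τ i)), show χ (τ i) = χ (τ j) from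
          hij] at h1
        have h2 := hTχ _ (T.mul_mem (T.inv_mem (τ j).2) (τ i).2)
          (mul_left_cancel₀ (hχ.ne_zero _) h1).symm
        exact τ.injective (Subtype.ext (inv_mul_eq_one.1 h2).symm)
      · intro i
        rw [← hsum i]
        refine Fintype.sum_equiv τ _ _ fun j => ?_
        rw [pow_add]
        ring
    -- G/T acts faithfully on l, so B t = 0 is a relation between distinct conjugates of θ and all
    -- its coefficients vanish.
    let ψ : G ⧸ T → Gal(l/k) := fun q => MulSemiringAction.toAlgAut G k l (s q)
    have hψ : Function.Injective ψ := fun q q' h => by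
      have h1 : ∀ x : l, s q • x = s q' • x := fun x => congrArg (fun σ : Gal(l/k) => σ x) h
      have h2 : (s q)⁻¹ * s q' ∈ T := (hT _).2 fun x => by
        rw [mul_smul, ← h1, inv_smul_smul]
      rw [← hs q, ← hs q']
      exact QuotientGroup.eq.2 h2
    have hli := Fintype.linearIndependent_iff.1 (hθ.comp ψ hψ)
    ext g
    obtain ⟨⟨t, q⟩, rfl⟩ := σ.surjective g
    refine hli (fun q => a.coeff (t * s q)) ?_ q
    rw [← hB t]
    exact Finset.sum_congr rfl fun q _ => Algebra.smul_def _ _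
  -- Both sides have |k|^(ef) = |l|^e elements, so injectivity suffices.
  have hcard : Nat.card (MonoidAlgebra k G) = Nat.card (∀ j : Fin e, Twist hχ (n + j)) := by
    rw [Nat.card_congr (MonoidAlgebra.coeffEquiv.trans Finsupp.equivFunOnFinite), Nat.card_fun, hG,
      mul_comm, pow_mul, ← hl, Nat.card_pi]
    exact (Fin.prod_const e _).symm
  have : Finite (MonoidAlgebra k G) :=
    Finite.of_equiv _ (MonoidAlgebra.coeffEquiv.trans Finsupp.equivFunOnFinite).symm
  exact ⟨(LinearEquiv.ofBijective (linearMapOfEquivariant Φ hequiv)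
    ((Nat.bijective_iff_injective_and_card _).2 ⟨hinj, hcard⟩)).symm⟩

end Twist

/-! ### Uniformizers and their cocycles. -/

section Uniformizer

variable {O : Type*} [CommRing O] [IsDomain O] [IsDiscreteValuationRing O] {G : Type*} [Group G]
  [MulSemiringAction G O] {π : O} (hπ : Irreducible π)

include hπ in
theorem dvd_smul_uniformizer (g : G) : π ∣ g • π := by
  have h : Irreducible (g • π) := (MulEquiv.irreducible_iff (MulSemiringAction.toRingEquiv G O g)).2 hπ
  exact (IsDiscreteValuationRing.associated_of_irreducible O hπ h).dvd

/-- The ratio of the image of a uniformizer under an automorphism to that uniformizer. -/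
def uniformizerRatio (g : G) : O := (dvd_smul_uniformizer hπ g).choose

theorem smul_uniformizer (g : G) : g • π = π * uniformizerRatio hπ g :=
  (dvd_smul_uniformizer hπ g).choose_spec

/-- The cocycle of `G` in the residue field attached to a uniformizer. -/
def uniformizerCocycle (g : G) : ResidueField O := residue O (uniformizerRatio hπ g)

theorem isCocycle_uniformizerCocycle : IsCocycle (uniformizerCocycle (G := G) hπ) where
  map_one := by
    have h : uniformizerRatio hπ (1 : G) = 1 := by
      apply mul_left_cancel₀ hπ.ne_zero
      rw [← smul_uniformizer, one_smul, mul_one]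
    rw [uniformizerCocycle, h, map_one]
  map_mul g h := by
    have h : uniformizerRatio hπ (g * h) = uniformizerRatio hπ g * g • uniformizerRatio hπ h := by
      apply mul_left_cancel₀ hπ.ne_zero
      rw [← smul_uniformizer, mul_smul, smul_uniformizer hπ h, smul_mul', smul_uniformizer hπ g]
      ring
    rw [uniformizerCocycle, h, _root_.map_mul, ResidueField.residue_smul]
    rfl

theorem uniformizerCocycle_eq_one {g : G} (hg : g • π = π) : uniformizerCocycle hπ g = 1 := by
  have h : uniformizerRatio hπ g = 1 := by
    apply mul_left_cancel₀ hπ.ne_zero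
    rw [← smul_uniformizer, hg, mul_one]
  rw [uniformizerCocycle, h, map_one]

variable (O) in
/-- A finite group acting faithfully on the residue field fixes a uniformizer. -/
theorem exists_irreducible_fixed {Q : Type*} [Group Q] [Finite Q] (s : Q →* G)
    (hs : ∀ q, (∀ x : ResidueField O, s q • x = x) → q = 1) :
    ∃ π : O, Irreducible π ∧ ∀ q, s q • π = π := by
  have := Fintype.ofFinite Q
  obtain ⟨π, hπ⟩ := IsDiscreteValuationRing.exists_irreducible O
  let ψ : Q → (ResidueField O →* ResidueField O) := fun q =>
    MulSemiringAction.toRingHom G (ResidueField O) (s q)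
  have hψ : Function.Injective ψ := fun q q' h => by
    have h1 : ∀ x : ResidueField O, s q • x = s q' • x := fun x => DFunLike.congr_fun h x
    refine (inv_mul_eq_one.1 (hs (q⁻¹ * q') fun x => ?_))
    rw [_root_.map_mul, mul_smul, ← h1, ← mul_smul, ← _root_.map_mul, inv_mul_cancel, _root_.map_one,
      one_smul]
  -- Independence of characters yields y for which the trace of yπ over Q is π times a unit. This
  -- trace is the fixed uniformizer.
  have hli := Fintype.linearIndependent_iff.1
    ((linearIndependent_monoidHom (ResidueField O) (ResidueField O)).comp ψ hψ)
    (fun q => uniformizerCocycle hπ (s q))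
  obtain ⟨y, hy⟩ : ∃ y : ResidueField O, ∑ q, uniformizerCocycle hπ (s q) * s q • y ≠ 0 := by
    by_contra! h
    have h1 := hli (by
      funext y
      refine Eq.trans ?_ (h y)
      rw [Finset.sum_apply]
      rfl) 1
    rw [_root_.map_one, (isCocycle_uniformizerCocycle hπ).map_one] at h1
    exact one_ne_zero h1
  obtain ⟨y, rfl⟩ := residue_surjective y
  have hsum : ∑ q, s q • (y * π) = π * ∑ q, uniformizerRatio hπ (s q) * s q • y := by
    rw [Finset.mul_sum]
    refine Finset.sum_congr rfl fun q _ => ?_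
    rw [smul_mul', smul_uniformizer hπ]
    ring
  have hu : IsUnit (∑ q, uniformizerRatio hπ (s q) * s q • y) := by
    rw [← residue_ne_zero_iff_isUnit, map_sum]
    simpa [uniformizerCocycle] using hy
  refine ⟨∑ q, s q • (y * π), ?_, fun r => ?_⟩
  · rw [hsum]
    exact (associated_mul_unit_right π _ hu).irreducible hπ
  · rw [Finset.smul_sum]
    refine Fintype.sum_equiv (Equiv.mulLeft r) _ _ fun q => ?_
    rw [Equiv.coe_mulLeft, _root_.map_mul, mul_smul]

/-- An automorphism of finite order prime to the residue characteristic which acts trivially on the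
residue field and on a uniformizer to first order is trivial. -/
theorem smul_eq_of_uniformizerCocycle_eq_one {t : G} {m : ℕ} (htm : t ^ m = 1)
    (hm : (m : ResidueField O) ≠ 0) (ht : ∀ x : ResidueField O, t • x = x)
    (htχ : uniformizerCocycle hπ t = 1) (x : O) : t • x = x := by
  -- As m is invertible, averaging over powers of t makes A π a fixed uniformizer and lifts every
  -- residue to a fixed element. Hence x is approximated by fixed elements modulo every power of A
  -- π, which forces t • x - x to vanish.
  let A : O → O := fun x => ∑ i ∈ Finset.range m, t ^ i • x
  have hA : ∀ x, t • A x = A x := fun x => by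
    have h1 := Finset.sum_range_succ (fun i => t ^ i • x) m
    rw [Finset.sum_range_succ', htm, pow_zero] at h1
    rw [Finset.smul_sum]
    simpa [← mul_smul, ← pow_succ'] using h1
  have htp : ∀ (i : ℕ) (x : ResidueField O), t ^ i • x = x := fun i x => by
    induction i with
    | zero => simp
    | succ i ih => rw [pow_succ, mul_smul, ht, ih]
  have hχp : ∀ i : ℕ, uniformizerCocycle hπ (t ^ i) = 1 := fun i => by
    induction i with
    | zero => rw [pow_zero, (isCocycle_uniformizerCocycle hπ).map_one]
    | succ i ih => rw [pow_succ, (isCocycle_uniformizerCocycle hπ).map_mul, ih, htp, htχ, mul_one]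
  have hAres : ∀ x, residue O (A x) = m * residue O x := fun x => by
    simp [A, ResidueField.residue_smul, htp]
  have hAπ : A π = π * ∑ i ∈ Finset.range m, uniformizerRatio hπ (t ^ i) := by
    rw [Finset.mul_sum]
    exact Finset.sum_congr rfl fun i _ => smul_uniformizer hπ _
  have hu : IsUnit (∑ i ∈ Finset.range m, uniformizerRatio hπ (t ^ i)) := by
    rw [← residue_ne_zero_iff_isUnit, map_sum]
    have : ∀ i, residue O (uniformizerRatio hπ (t ^ i)) = 1 := hχp
    simpa [this] using hm
  have hπ' : Irreducible (A π) := hAπ ▸ (associated_mul_unit_right π _ hu).irreducible hπ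
  have hmu : IsUnit (m : O) := by
    rw [← residue_ne_zero_iff_isUnit, map_natCast]
    exact hm
  obtain ⟨m', hm'⟩ := hmu.exists_left_inv
  have hm't : t • m' = m' := by
    apply mul_right_cancel₀ hmu.ne_zero
    rw [hm', ← smul_one t, ← hm', smul_mul']
    congr 1
    exact (map_natCast (MulSemiringAction.toRingHom G O t) m).symm
  have hres : ∀ z, ∃ z', t • z' = z' ∧ A π ∣ z - z' := fun z => by
    refine ⟨m' * A z, by rw [smul_mul', hm't, hA], ?_⟩
    rw [← residue_eq_zero_iff_dvd hπ', map_sub, _root_.map_mul, hAres, ← map_natCast (residue O),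
      ← mul_assoc, ← _root_.map_mul, hm', _root_.map_one, one_mul, sub_self]
  have happrox : ∀ n : ℕ, ∃ y, t • y = y ∧ A π ^ n ∣ x - y := fun n => by
    induction n with
    | zero => exact ⟨0, smul_zero _, by simp⟩
    | succ n ih =>
      obtain ⟨y, hy, z, hz⟩ := ih
      obtain ⟨z', hz', w, hw⟩ := hres z
      refine ⟨y + A π ^ n * z', ?_, w, ?_⟩
      · rw [smul_add, hy, smul_mul', smul_pow', hA, hz']
      · rw [pow_succ, mul_assoc, ← hw, mul_sub, ← hz]
        ring
  by_contra hne
  obtain ⟨w, a, hw, ha⟩ := exists_eq_isUnit_mul_pow hπ' (sub_ne_zero.2 hne)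
  obtain ⟨y, hy, z, hz⟩ := happrox (a + 1)
  have h1 : A π ^ (a + 1) ∣ w * A π ^ a := by
    rw [← ha]
    have : t • x - x = t • (x - y) - (x - y) := by
      rw [smul_sub, hy]
      ring
    rw [this, hz, smul_mul', smul_pow', hA, ← mul_sub]
    exact dvd_mul_right _ _
  have := le_of_pow_dvd_isUnit_mul_pow hπ' hw h1
  omega

end Uniformizer

/-- Descent of an equivariant additive map along an equivariant surjection. -/
theorem exists_linearMap_of_equivariant {p : ℕ} [Fact p.Prime] {G : Type*} [Group G]
    {S N V : Type*} [AddCommGroup S] [AddCommGroup N] [Module (MonoidAlgebra (ZMod p) G) N]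
    [AddCommGroup V] [Module (MonoidAlgebra (ZMod p) G) V] (q : S →+ N)
    (hq : Function.Surjective q) (r : S →+ V) (act : G → S → S)
    (hqa : ∀ g s, q (act g s) = MonoidAlgebra.single g (1 : ZMod p) • q s)
    (hra : ∀ g s, r (act g s) = MonoidAlgebra.single g (1 : ZMod p) • r s)
    (hker : ∀ s, q s = 0 → r s = 0) :
    ∃ f : N →ₗ[MonoidAlgebra (ZMod p) G] V, ∀ s, f (q s) = r s := by
  let f : N →+ V := q.liftOfSurjective hq ⟨r, fun s hs => hker s hs⟩
  have hf : ∀ s, f (q s) = r s := fun s =>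
    AddMonoidHom.liftOfRightInverse_comp_apply q _ (Function.rightInverse_surjInv hq)
      ⟨r, fun s hs => hker s hs⟩ s
  refine ⟨linearMapOfEquivariant f fun g x => ?_, hf⟩
  obtain ⟨s, rfl⟩ := hq x
  rw [← hqa, hf, hf, hra]

/-! ### The twists of a tame split extension. -/

section Residue

variable (p : ℕ) [Fact p.Prime] (K L : Type*) [Field K] [Field L] [Algebra K L]
  [Algebra ℚ_[p] K] [Algebra ℚ_[p] L] [IsScalarTower ℚ_[p] K L]
  [Algebra ℤ_[p] K] [IsScalarTower ℤ_[p] ℚ_[p] K]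
  [Algebra ℤ_[p] L] [IsScalarTower ℤ_[p] ℚ_[p] L] [IsScalarTower ℤ_[p] K L]
  [FiniteDimensional ℚ_[p] K] [FiniteDimensional ℚ_[p] L]

instance smulCommClass_resField : SMulCommClass Gal(L/K) (ResField p K) (ResField p L) where
  smul_comm g a x := by
    have h : g • algebraMap (ResField p K) (ResField p L) a = algebraMap _ _ a := by
      obtain ⟨a, rfl⟩ := residue_surjective a
      rw [ResidueField.algebraMap_residue, ← ResidueField.residue_smul]
      congr 1
      ext
      exact g.commutes a
    rw [Algebra.smul_def, Algebra.smul_def, smul_mul', h]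

theorem mem_inertiaGroup_iff (g : Gal(L/K)) :
    g ∈ inertiaGroup p K L ↔ ∀ x : ResField p L, g • x = x := by
  have h : ∀ x : IntRing p L, g • x - x ∈ maxIdeal p L ↔
      g • residue (IntRing p L) x = residue _ x := fun x => by
    rw [← residue_eq_zero_iff, map_sub, ResidueField.residue_smul, sub_eq_zero]
  constructor
  · intro hg x
    obtain ⟨x, rfl⟩ := residue_surjective x
    exact (h x).1 (hg x)
  · exact fun hg x => (h x).2 (hg _)

theorem gal_eq_one_of_smul_intRing {g : Gal(L/K)} (hg : ∀ x : IntRing p L, g • x = x) : g = 1 := by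
  ext x
  obtain ⟨a, b, hb, rfl⟩ := IsFractionRing.div_surjective (A := IntRing p L) x
  have h : ∀ y : IntRing p L, g (algebraMap _ L y) = algebraMap _ L y := fun y =>
    congrArg Subtype.val (hg y)
  rw [map_div₀, h, h]
  rfl

/-- The twists of the residue field of a tame split extension by the powers of the cocycle of a
suitable uniformizer add up to copies of `k[G]`. -/
theorem exists_uniformizer_twist_block_equiv [IsGalois K L] (htame : IsTame p K L)
    (hsplit : IsSplitExt p K L) :
    ∃ (π : IntRing p L) (hπ : Irreducible π), ∀ n, Nonempty
      ((∀ j : Fin ((maxIdeal p L).ramificationIdx (IntRing p K)),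
        Twist (isCocycle_uniformizerCocycle (G := Gal(L/K)) hπ) (n + j))
          ≃ₗ[MonoidAlgebra (ZMod p) Gal(L/K)] MonoidAlgebra (ResField p K) Gal(L/K)) := by
  have := finite_gal p K L
  obtain ⟨s, hs⟩ := hsplit
  -- Splitness enters here: the image of the section acts faithfully on l, so it fixes some
  -- uniformizer.
  obtain ⟨π, hπ, hfix⟩ := exists_irreducible_fixed (IntRing p L) s fun q hq => by
    rw [← hs q]
    exact (QuotientGroup.eq_one_iff _).2 ((mem_inertiaGroup_iff p K L _).2 hq)
  refine ⟨π, hπ, fun n => ?_⟩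
  refine nonempty_twist_block_equiv p (isCocycle_uniformizerCocycle hπ) n (fun g a => ?_)
    (inertiaGroup p K L) (mem_inertiaGroup_iff p K L) (fun t ht htχ => ?_) s hs
    (fun q => uniformizerCocycle_eq_one hπ (hfix q)) (natCard_inertiaGroup p K L)
    (natCard_gal p K L) (natCard_resField_tower p K L)
  · change MonoidAlgebra.mapRingHom _ _ (MonoidAlgebra.single g 1) * a = _
    simp
  -- Tameness enters here: the order of T is invertible in l, so χ is faithful on T.
  · refine gal_eq_one_of_smul_intRing p K L (smul_eq_of_uniformizerCocycle_eq_one hπ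
      (m := Nat.card (inertiaGroup p K L)) ?_ ?_ ((mem_inertiaGroup_iff p K L _).1 ht) htχ)
    · exact congrArg Subtype.val (pow_card_eq_one' (x := (⟨t, ht⟩ : inertiaGroup p K L)))
    · rw [natCard_inertiaGroup, Ne, CharP.cast_eq_zero_iff _ p]
      exact htame

end Residue

/-! ### Graded pieces of the unit filtration modulo p-th powers. -/

section Graded

variable (p : ℕ) [Fact p.Prime] (K L : Type*) [Field K] [Field L] [Algebra K L]
  [Algebra ℚ_[p] K] [Algebra ℚ_[p] L] [IsScalarTower ℚ_[p] K L]
  [Algebra ℤ_[p] K] [IsScalarTower ℤ_[p] ℚ_[p] K]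
  [Algebra ℤ_[p] L] [IsScalarTower ℤ_[p] ℚ_[p] L] [IsScalarTower ℤ_[p] K L]
  [FiniteDimensional ℚ_[p] K] [FiniteDimensional ℚ_[p] L]

theorem single_smul_toUnitsModP (g : Gal(L/K)) (u : Lˣ) :
    MonoidAlgebra.single g (1 : ZMod p) • toUnitsModP p L (.ofMul u) =
      toUnitsModP p L (.ofMul (Units.map (g : L →* L) u)) := by
  change (galRep p K L).asAlgebraHom (MonoidAlgebra.single g 1) _ = _
  rw [Representation.asAlgebraHom_single, one_smul]
  rfl

theorem toUnitsModP_eq_iff (u w : Lˣ) :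
    toUnitsModP p L (.ofMul u) = toUnitsModP p L (.ofMul w) ↔ ∃ v : Lˣ, w = u * v ^ p := by
  have h : toUnitsModP p L (.ofMul u) = toUnitsModP p L (.ofMul w) ↔
      (QuotientGroup.mk u : Lˣ ⧸ pthPowers p L) = QuotientGroup.mk w := Iff.rfl
  rw [h, QuotientGroup.eq]
  constructor
  · rintro ⟨v, hv⟩
    exact ⟨v, by rw [← powMonoidHom_apply, hv, mul_inv_cancel_left]⟩
  · rintro ⟨v, rfl⟩
    exact ⟨v, by simp⟩

variable {p L} {π : IntRing p L} (hπ : Irreducible π)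

include hπ in
theorem mem_unitGroup_iff_uniformizer {n : ℕ} (hn : 0 < n) (u : Lˣ) :
    u ∈ unitGroup p L n ↔ ∃ y : IntRing p L, (u : L) = (1 + π ^ n * y : IntRing p L) := by
  rw [mem_unitGroup_iff p L hn, maxIdeal, hπ.maximalIdeal_eq, Ideal.span_singleton_pow]
  constructor
  · rintro ⟨a, ha, h⟩
    obtain ⟨y, rfl⟩ := Ideal.mem_span_singleton.1 ha
    exact ⟨y, by rw [h]; rfl⟩
  · rintro ⟨y, h⟩
    exact ⟨π ^ n * y, Ideal.mem_span_singleton.2 (dvd_mul_right _ _), by rw [h]; rfl⟩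

include hπ in
theorem exists_unit_eq {n : ℕ} (hn : 0 < n) (y : IntRing p L) :
    ∃ u ∈ unitGroup p L n, (u : L) = (1 + π ^ n * y : IntRing p L) := by
  obtain ⟨m, rfl⟩ := Nat.exists_eq_add_of_le' hn
  have h := isUnit_add_mul_uniformizer hπ isUnit_one (π ^ m * y)
  rw [← mul_assoc, ← pow_succ'] at h
  have h0 : ((1 + π ^ (m + 1) * y : IntRing p L) : L) ≠ 0 := by
    rw [Ne, ZeroMemClass.coe_eq_zero]
    exact h.ne_zero
  exact ⟨Units.mk0 _ h0, (mem_unitGroup_iff_uniformizer hπ hn _).2 ⟨y, rfl⟩, rfl⟩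

theorem unitGroup_antitone : Antitone (unitGroup p L) := by
  rintro m n hmn _ ⟨v, hv, rfl⟩
  refine ⟨v, ?_, rfl⟩
  have h := congrArg Units.val (MonoidHom.mem_ker.1 hv)
  refine MonoidHom.mem_ker.2 (Units.ext ?_)
  change Ideal.Quotient.mk _ (v : IntRing p L) = 1 at h
  change Ideal.Quotient.mk _ (v : IntRing p L) = 1
  rw [← map_one (Ideal.Quotient.mk _), Ideal.Quotient.eq] at h ⊢
  exact Ideal.pow_le_pow_right hmn h

/-- The coefficient `y` of a unit `1 + π ^ n * y` of level `n`. -/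
def unitCoeff {n : ℕ} (hn : 0 < n) (u : unitGroup p L n) : IntRing p L :=
  ((mem_unitGroup_iff_uniformizer hπ hn u).1 u.2).choose

theorem unitCoeff_spec {n : ℕ} (hn : 0 < n) (u : unitGroup p L n) :
    ((u : Lˣ) : L) = (1 + π ^ n * unitCoeff hπ hn u : IntRing p L) :=
  ((mem_unitGroup_iff_uniformizer hπ hn u).1 u.2).choose_spec

theorem unitCoeff_eq {n : ℕ} (hn : 0 < n) (u : unitGroup p L n) {y : IntRing p L}
    (hy : ((u : Lˣ) : L) = (1 + π ^ n * y : IntRing p L)) : unitCoeff hπ hn u = y := by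
  have h : 1 + π ^ n * unitCoeff hπ hn u = 1 + π ^ n * y :=
    Subtype.ext ((unitCoeff_spec hπ hn u).symm.trans hy)
  exact mul_left_cancel₀ (pow_ne_zero n hπ.ne_zero) (add_left_cancel h)

/-- The leading coefficient of a unit of level `n`. -/
def leadingCoeff {n : ℕ} (hn : 0 < n) : Additive (unitGroup p L n) →+ ResField p L :=
  AddMonoidHom.mk' (fun u => residue _ (unitCoeff hπ hn u.toMul)) fun u v => by
    have h : unitCoeff hπ hn (u + v).toMul = unitCoeff hπ hn u.toMul + unitCoeff hπ hn v.toMul +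
        π ^ n * (unitCoeff hπ hn u.toMul * unitCoeff hπ hn v.toMul) := by
      apply unitCoeff_eq
      change ((u.toMul : Lˣ) : L) * ((v.toMul : Lˣ) : L) = _
      rw [unitCoeff_spec hπ hn u.toMul, unitCoeff_spec hπ hn v.toMul, ← MulMemClass.coe_mul]
      congr 1
      ring
    rw [h, map_add, map_add, (residue_eq_zero_iff_dvd hπ _).2
      (Dvd.dvd.mul_right (dvd_pow_self π hn.ne') _), add_zero]

theorem leadingCoeff_apply {n : ℕ} (hn : 0 < n) (u : unitGroup p L n) :
    leadingCoeff hπ hn (.ofMul u) = residue _ (unitCoeff hπ hn u) := rfl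

theorem leadingCoeff_surjective {n : ℕ} (hn : 0 < n) :
    Function.Surjective (leadingCoeff (p := p) (L := L) hπ hn) := fun x => by
  obtain ⟨y, rfl⟩ := residue_surjective x
  obtain ⟨u, hu, huy⟩ := exists_unit_eq hπ hn y
  exact ⟨.ofMul ⟨u, hu⟩, by rw [leadingCoeff_apply, unitCoeff_eq hπ hn ⟨u, hu⟩ huy]⟩

theorem leadingCoeff_eq_zero_iff {n : ℕ} (hn : 0 < n) (u : unitGroup p L n) :
    leadingCoeff hπ hn (.ofMul u) = 0 ↔ (u : Lˣ) ∈ unitGroup p L (n + 1) := by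
  rw [leadingCoeff_apply, residue_eq_zero_iff_dvd hπ,
    mem_unitGroup_iff_uniformizer hπ n.succ_pos]
  constructor
  · rintro ⟨z, hz⟩
    exact ⟨z, by rw [unitCoeff_spec hπ hn u, hz, pow_succ, mul_assoc]⟩
  · rintro ⟨z, hz⟩
    rw [pow_succ, mul_assoc] at hz
    exact ⟨z, unitCoeff_eq hπ hn u hz⟩

/-- The action of an automorphism on the units of level `n`. -/
def galUnitGroup (n : ℕ) (g : Gal(L/K)) (u : Additive (unitGroup p L n)) :
    Additive (unitGroup p L n) :=
  .ofMul ⟨Units.map (g : L →* L) (u.toMul : Lˣ), unitGroup_galStable n g _ u.toMul.2⟩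

/-- Applying g to 1 + π^n y multiplies the coefficient g(y) by (g(π)/π)^n. This is the action
defining the n-th twist. -/
theorem leadingCoeff_galUnitGroup {n : ℕ} (hn : 0 < n) (g : Gal(L/K))
    (u : Additive (unitGroup p L n)) : leadingCoeff hπ hn (galUnitGroup K n g u) =
      uniformizerCocycle hπ g ^ n * g • leadingCoeff hπ hn u := by
  have h : unitCoeff hπ hn (galUnitGroup K n g u).toMul =
      uniformizerRatio hπ g ^ n * g • unitCoeff hπ hn u.toMul := by
    apply unitCoeff_eq
    change g ((u.toMul : Lˣ) : L) = _
    rw [unitCoeff_spec hπ hn u.toMul]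
    change ((g • (1 + π ^ n * unitCoeff hπ hn u.toMul) : IntRing p L) : L) = _
    rw [smul_add, smul_one, smul_mul', smul_pow', smul_uniformizer hπ, mul_pow, mul_assoc]
  change residue _ (unitCoeff hπ hn (galUnitGroup K n g u).toMul) = _
  rw [h, map_mul, map_pow, ResidueField.residue_smul]
  rfl

/-- The image of the units of level `n` in the quotient of `L^× / L^{× p}` by the image of the units
of level `b`. -/
def unitBarMod (b n : ℕ) : Submodule (MonoidAlgebra (ZMod p) Gal(L/K))
    (UnitsModP p L ⧸ unitBar p K L b) :=
  (unitBar p K L n).map (unitBar p K L b).mkQ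

/-- The class of a unit of level `n`. -/
def unitBarModMk (b n : ℕ) : Additive (unitGroup p L n) →+ unitBarMod (p := p) (L := L) K b n where
  toFun u := ⟨Submodule.Quotient.mk (toUnitsModP p L (.ofMul (u.toMul : Lˣ))),
    ⟨_, ⟨_, u.toMul.2, rfl⟩, rfl⟩⟩
  map_zero' := rfl
  map_add' _ _ := rfl

theorem unitBarModMk_surjective (b n : ℕ) :
    Function.Surjective (unitBarModMk (p := p) (L := L) K b n) := by
  rintro ⟨_, ⟨_, ⟨u, hu, rfl⟩, rfl⟩⟩
  exact ⟨.ofMul ⟨u, hu⟩, rfl⟩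

theorem unitBarMod_antitone (b : ℕ) : Antitone (unitBarMod (p := p) (L := L) K b) :=
  fun _ _ hmn => Submodule.map_mono fun _ ⟨u, hu, hx⟩ => ⟨u, unitGroup_antitone hmn hu, hx⟩

theorem unitBarMod_self (b : ℕ) : unitBarMod (p := p) (L := L) K b b = ⊥ :=
  Submodule.mkQ_map_self _

/-- For n = pj, dividing a unit of level n by the p-th power of a suitable 1 + aπ^j raises its level
without changing its class. -/
theorem unitBarMod_le_succ {c : ℕ} (hc : absRam p L = c * (p - 1)) {n : ℕ} (hn : 0 < n)
    (hnc : n < c * p) (hpn : p ∣ n) (b : ℕ) :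
    unitBarMod (p := p) (L := L) K b n ≤ unitBarMod K b (n + 1) := by
  have hpp : p.Prime := Fact.out
  obtain ⟨π, hπ⟩ := IsDiscreteValuationRing.exists_irreducible (IntRing p L)
  obtain ⟨j, rfl⟩ := hpn
  have hj : 0 < j := Nat.pos_of_mul_pos_left hn
  refine Submodule.map_mono ?_
  rintro _ ⟨u, hu, rfl⟩
  obtain ⟨y, hy⟩ := (mem_unitGroup_iff_uniformizer hπ hn u).1 hu
  obtain ⟨a, ha⟩ := exists_pow_congr_of_dvd (p := p) hπ (hc ▸ associated_natCast_pow p L hπ)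
    (show j < c by rw [mul_comm] at hnc; exact Nat.lt_of_mul_lt_mul_right hnc) y
  obtain ⟨z, hz⟩ := ha
  obtain ⟨v, hv, hva⟩ := exists_unit_eq hπ hj a
  obtain ⟨a', ha'⟩ := (mem_unitGroup_iff_uniformizer hπ hj _).1 (inv_mem hv)
  refine ⟨.ofMul (Additive.toMul u * (v ^ p)⁻¹), ?_,
    (toUnitsModP_eq_iff p L _ _).2 ⟨v, (inv_mul_cancel_right _ _).symm⟩⟩
  refine (mem_unitGroup_iff_uniformizer hπ (Nat.succ_pos _) _).2 ⟨z * (1 + π ^ j * a') ^ p, ?_⟩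
  have h1 : (1 + π ^ j * a) * (1 + π ^ j * a') = 1 := by
    ext
    rw [MulMemClass.coe_mul, ← hva, ← ha', ← Units.val_mul, mul_inv_cancel]
    rfl
  have h2 : (1 + π ^ (p * j) * y) * (1 + π ^ j * a') ^ p =
      1 + π ^ (p * j + 1) * (z * (1 + π ^ j * a') ^ p) := by
    rw [← mul_assoc, ← hz, mul_comm a, mul_comm y, sub_mul, ← mul_pow, h1, one_pow]
    ring
  rw [← h2, MulMemClass.coe_mul, SubmonoidClass.coe_pow, ← ha', ← hy, ← inv_pow]
  rfl

include hπ in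
theorem pow_mem_unitGroup_succ {c : ℕ} (hc : absRam p L = c * (p - 1)) {n : ℕ} (hn : 0 < n)
    (hnc : n < c * p) (hpn : ¬ p ∣ n) {v : Lˣ} (hv : v ^ p ∈ unitGroup p L n) :
    v ^ p ∈ unitGroup p L (n + 1) := by
  have hpp : p.Prime := Fact.out
  obtain ⟨y, hy⟩ := (mem_unitGroup_iff_uniformizer hπ hn _).1 hv
  rw [Units.val_pow_eq_pow_val] at hy
  have hint : (v : L) ∈ IntRing p L := IsIntegral.of_pow hpp.pos (by rw [hy]; exact Subtype.property _)
  have hy' : (⟨v, hint⟩ : IntRing p L) ^ p = 1 + π ^ n * y := Subtype.ext hy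
  obtain ⟨z, hz⟩ := pow_succ_dvd_pow_sub_one (p := p) hπ (hc ▸ associated_natCast_pow p L hπ) hn hnc
    hpn (v := ⟨v, hint⟩) ⟨y, by rw [hy']; ring⟩
  refine (mem_unitGroup_iff_uniformizer hπ n.succ_pos _).2 ⟨z, ?_⟩
  rw [← hz, add_sub_cancel]
  rfl

/-- The leading coefficient descends to classes: a unit of level n with trivial class is a unit of
level cp times a p-th power. That power has level n, hence level n + 1 because p ∤ n, and cp ≥ n +
1. -/
theorem exists_unitBarMod_linearMap {c : ℕ} (hc : absRam p L = c * (p - 1)) {n : ℕ} (hn : 0 < n)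
    (hnc : n < c * p) (hpn : ¬ p ∣ n) :
    ∃ f : unitBarMod (p := p) (L := L) K (c * p) n →ₗ[MonoidAlgebra (ZMod p) Gal(L/K)]
        Twist (isCocycle_uniformizerCocycle (G := Gal(L/K)) hπ) n,
      Function.Surjective f ∧ ∀ x, f x = 0 ↔
        (x : UnitsModP p L ⧸ unitBar p K L (c * p)) ∈ unitBarMod (p := p) (L := L) K (c * p) (n + 1) := by
  let r : Additive (unitGroup p L n) →+
      Twist (isCocycle_uniformizerCocycle (G := Gal(L/K)) hπ) n :=
    (Twist.of _ n).toAddMonoidHom.comp (leadingCoeff hπ hn)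
  have hr : ∀ u, r u = Twist.of _ n (leadingCoeff hπ hn u) := fun _ => rfl
  obtain ⟨f, hf⟩ := exists_linearMap_of_equivariant (p := p) (G := Gal(L/K))
    (unitBarModMk K (c * p) n) (unitBarModMk_surjective K _ n) r (galUnitGroup K n)
    (fun g u => Subtype.ext (by
      change Submodule.Quotient.mk (toUnitsModP p L _) = MonoidAlgebra.single g 1 •
        Submodule.Quotient.mk (toUnitsModP p L _)
      rw [← Submodule.Quotient.mk_smul, single_smul_toUnitsModP]
      rfl))
    (fun g u => by rw [hr, hr, leadingCoeff_galUnitGroup, single_smul_twist_of])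
    (fun u hu => by
      rw [hr, EmbeddingLike.map_eq_zero_iff]
      refine (leadingCoeff_eq_zero_iff hπ hn u.toMul).2 ?_
      obtain ⟨w, hw, hwu⟩ := (Submodule.Quotient.mk_eq_zero _).1 (congrArg Subtype.val hu)
      obtain ⟨v, hv⟩ := (toUnitsModP_eq_iff p L w.toMul _).1 hwu
      rw [hv]
      have hw' : w.toMul ∈ unitGroup p L (n + 1) := unitGroup_antitone (show n + 1 ≤ c * p from hnc) hw
      refine mul_mem hw' ?_
      have hvp : v ^ p ∈ unitGroup p L n := by
        rw [show v ^ p = w.toMul⁻¹ * (u.toMul : Lˣ) by rw [hv, inv_mul_cancel_left]]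
        exact mul_mem (inv_mem (unitGroup_antitone n.le_succ hw')) u.toMul.2
      exact pow_mem_unitGroup_succ hπ hc hn hnc hpn hvp)
  refine ⟨f, fun x => ?_, fun x => ?_⟩
  · obtain ⟨x, rfl⟩ := (Twist.of _ n).surjective x
    obtain ⟨u, rfl⟩ := leadingCoeff_surjective hπ hn x
    exact ⟨_, hf u⟩
  · obtain ⟨u, rfl⟩ := unitBarModMk_surjective K _ n x
    rw [hf, hr, EmbeddingLike.map_eq_zero_iff]
    constructor
    · intro h
      exact ⟨_, ⟨_, (leadingCoeff_eq_zero_iff hπ hn u.toMul).1 h, rfl⟩, rfl⟩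
    · rintro ⟨_, ⟨w, hw, rfl⟩, h⟩
      let w' : unitGroup p L n := ⟨w, unitGroup_antitone n.le_succ hw⟩
      have h1 : unitBarModMk K (c * p) n (.ofMul w') = unitBarModMk K (c * p) n u := Subtype.ext h
      have h2 := hf u
      rw [← h1, hf, hr, hr, EmbeddingLike.apply_eq_iff_eq] at h2
      rw [← h2]
      exact (leadingCoeff_eq_zero_iff hπ hn w').2 hw

end Graded

/-- Taking prime-to-`p` parts identifies the integers of `(c, c * p]`, cut into `E` blocks of length
`e`, with the integers prime to `p` in `[1, c * p)`. -/
theorem exists_equiv_not_dvd {p c E e : ℕ} (hp : p.Prime) (h : E * e + c = c * p) :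
    ∃ σ : (Σ _ : Fin E, Fin e) ≃ {i // 1 ≤ i ∧ i < c * p ∧ ¬ p ∣ i},
      ∀ x, ∃ u, c + 1 + e * x.1 + x.2 = p ^ u * (σ x : ℕ) := by
  let j : (Σ _ : Fin E, Fin e) → ℕ := fun x => c + 1 + e * x.1 + x.2
  have hj : ∀ x, c < j x ∧ j x ≤ c * p := fun ⟨a, b⟩ => by
    have h1 : e * (a + 1) ≤ E * e := by
      rw [mul_comm E]
      exact Nat.mul_le_mul_left _ a.2
    have := b.2
    rw [mul_add] at h1
    dsimp only [j]
    omega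
  have hinj : ∀ x y, j x = j y → x = y := by
    rintro ⟨a, b⟩ ⟨a', b'⟩ hxy
    have h1 : e * (a : ℕ) + b = e * a' + b' := by
      dsimp only [j] at hxy
      omega
    have h2 := congrArg (· / e) h1
    have h3 := congrArg (· % e) h1
    simp only [Nat.mul_add_div (Nat.zero_lt_of_lt b.2), Nat.mul_add_mod, Nat.mod_eq_of_lt b.2,
      Nat.mod_eq_of_lt b'.2, Nat.div_eq_of_lt b.2, Nat.div_eq_of_lt b'.2, add_zero] at h2 h3
    obtain rfl : a = a' := Fin.ext h2
    obtain rfl : b = b' := Fin.ext h3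
    rfl
  have hsurj : ∀ m, c < m → m ≤ c * p → ∃ x, j x = m := fun m h1 h2 => by
    obtain ⟨d, rfl⟩ := Nat.exists_eq_add_of_lt h1
    have hd : d < e * E := by
      rw [mul_comm]
      omega
    refine ⟨⟨⟨d / e, Nat.div_lt_of_lt_mul hd⟩,
      ⟨d % e, Nat.mod_lt _ (Nat.pos_of_mul_pos_right (Nat.zero_lt_of_lt hd))⟩⟩, ?_⟩
    have := Nat.div_add_mod d e
    dsimp only [j]
    omega
  have hproj : ∀ x, p ^ (j x).factorization p * (j x / p ^ (j x).factorization p) = j x :=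
    fun x => Nat.ordProj_mul_ordCompl_eq_self (j x) p
  have hnd : ∀ x, ¬ p ∣ j x / p ^ (j x).factorization p :=
    fun x => Nat.not_dvd_ordCompl hp (Nat.ne_zero_of_lt (hj x).1)
  let f : (Σ _ : Fin E, Fin e) → {i // 1 ≤ i ∧ i < c * p ∧ ¬ p ∣ i} := fun x =>
    ⟨j x / p ^ (j x).factorization p, Nat.ordCompl_pos p (Nat.ne_zero_of_lt (hj x).1),
      lt_of_le_of_ne ((Nat.ordCompl_le _ p).trans (hj x).2) fun h0 =>
        hnd x (h0 ▸ dvd_mul_left p c), hnd x⟩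
  -- Two integers with the same prime-to-p part and different exponents have ratio at least p,
  -- impossible inside (c, cp].
  have key : ∀ x y, f x = f y → (j x).factorization p ≤ (j y).factorization p := fun x y hxy => by
    have h1 : j x / p ^ (j x).factorization p = j y / p ^ (j y).factorization p :=
      congrArg Subtype.val hxy
    by_contra! hlt
    have h2 : p * j y ≤ j x := by
      rw [← hproj x, ← hproj y, h1, ← mul_assoc, ← pow_succ']
      exact Nat.mul_le_mul_right _ (Nat.pow_le_pow_right hp.pos hlt)
    have h3 : c * p < j y * p := Nat.mul_lt_mul_of_pos_right (hj y).1 hp.pos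
    have := (hj x).2
    rw [mul_comm] at h2
    omega
  refine ⟨Equiv.ofBijective f ⟨fun x y hxy => hinj x y ?_, fun ⟨i, hi1, hi2, hi3⟩ => ?_⟩,
    fun x => ⟨_, (hproj x).symm⟩⟩
  · have h1 : j x / p ^ (j x).factorization p = j y / p ^ (j y).factorization p :=
      congrArg Subtype.val hxy
    rw [← hproj x, h1, le_antisymm (key x y hxy) (key y x hxy.symm), hproj]
  -- The least u with p^u·i > c works: minimality gives p^u·i ≤ cp when u > 0, and i < cp covers u =
  -- 0.
  · have hex : ∃ u, c < p ^ u * i := by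
      obtain ⟨u, hu⟩ := pow_unbounded_of_one_lt c hp.one_lt
      exact ⟨u, hu.trans_le (Nat.le_mul_of_pos_right _ hi1)⟩
    obtain ⟨x, hx⟩ := hsurj (p ^ Nat.find hex * i) (Nat.find_spec hex) (by
      rcases Nat.eq_zero_or_pos (Nat.find hex) with h0 | h0
      · rw [h0, pow_zero, one_mul]
        exact hi2.le
      · obtain ⟨v, hv⟩ := Nat.exists_eq_add_of_le' h0
        have := Nat.find_min hex (show v < Nat.find hex by omega)
        rw [hv, pow_succ, mul_right_comm]
        exact Nat.mul_le_mul_right p (not_lt.1 this))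
    exact ⟨x, Subtype.ext (by
      change j x / p ^ (j x).factorization p = i
      rw [hx]
      exact Nat.ordCompl_pow_mul_of_not_dvd _ hp hi3)⟩

/-! ### Assembly of the unit quotient from blocks of twists. -/

section Freeness

variable (p : ℕ) [Fact p.Prime] (K L : Type*) [Field K] [Field L] [Algebra K L]
  [Algebra ℚ_[p] K] [Algebra ℚ_[p] L] [IsScalarTower ℚ_[p] K L]
  [Algebra ℤ_[p] K] [IsScalarTower ℤ_[p] ℚ_[p] K]
  [Algebra ℤ_[p] L] [IsScalarTower ℤ_[p] ℚ_[p] L] [IsScalarTower ℤ_[p] K L]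
  [FiniteDimensional ℚ_[p] K] [FiniteDimensional ℚ_[p] L]

theorem nonempty_resField_monoidAlgebra_equiv :
    Nonempty (MonoidAlgebra (ResField p K) Gal(L/K) ≃ₗ[MonoidAlgebra (ZMod p) Gal(L/K)]
      (Fin ((maxIdeal p K).inertiaDeg ℤ_[p]) → MonoidAlgebra (ZMod p) Gal(L/K))) := by
  have := finite_gal p K L
  refine nonempty_monoidAlgebra_equiv (natCard_resField p K) fun g a => ?_
  change MonoidAlgebra.mapRingHom _ _ (MonoidAlgebra.single g 1) * a = _
  simp

theorem nonempty_pi_monoidAlgebra_equiv :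
    Nonempty ((Fin (absRam p K) → MonoidAlgebra (ResField p K) Gal(L/K))
      ≃ₗ[MonoidAlgebra (ZMod p) Gal(L/K)]
        (Fin (finrank ℚ_[p] K) → MonoidAlgebra (ZMod p) Gal(L/K))) := by
  obtain ⟨E⟩ := nonempty_resField_monoidAlgebra_equiv p K L
  rw [finrank_eq_absRam_mul]
  exact ⟨(LinearEquiv.piCongrRight fun _ => E).trans
    ((LinearEquiv.curry (MonoidAlgebra (ZMod p) Gal(L/K)) (MonoidAlgebra (ZMod p) Gal(L/K))
      (Fin (absRam p K)) (Fin ((maxIdeal p K).inertiaDeg ℤ_[p]))).symm.trans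
      (LinearEquiv.funCongrLeft _ _ finProdFinEquiv.symm))⟩

variable [IsGalois K L]

/-- The quotient `Ū_L^1 / Ū_L^{cp}` of a tame split extension with `e_L = c (p - 1)`. -/
theorem nonempty_unitBarQuot_equiv (htame : IsTame p K L) (hsplit : IsSplitExt p K L) {c : ℕ}
    (hc : absRam p L = c * (p - 1)) :
    Nonempty (unitBarQuot p K L (c * p) ≃ₗ[MonoidAlgebra (ZMod p) Gal(L/K)]
      (Fin (absRam p K) → MonoidAlgebra (ResField p K) Gal(L/K))) := by
  have hpp : p.Prime := Fact.out
  have hc0 : 0 < c := Nat.pos_of_mul_pos_right (hc ▸ absRam_pos p L)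
  obtain ⟨π, hπ, hblock⟩ := exists_uniformizer_twist_block_equiv p K L htame hsplit
  let hχ := isCocycle_uniformizerCocycle (G := Gal(L/K)) hπ
  -- Each twist is a direct summand of the block starting at it, and that block is free over F_p[G].
  have hproj : ∀ i, Module.Projective (MonoidAlgebra (ZMod p) Gal(L/K)) (Twist hχ i) := fun i => by
    obtain ⟨E⟩ := hblock i
    obtain ⟨E'⟩ := nonempty_resField_monoidAlgebra_equiv p K L
    have := Module.Projective.of_equiv (E.trans E').symm
    let j : Fin ((maxIdeal p L).ramificationIdx (IntRing p K)) :=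
      ⟨0, Ideal.ramificationIdx_pos _ _⟩
    exact Module.Projective.of_split (LinearMap.single _ (fun j : Fin _ => Twist hχ (i + j)) j)
      (LinearMap.proj j) (LinearMap.proj_comp_single_same _ _ j)
  have hEe : absRam p K * (maxIdeal p L).ramificationIdx (IntRing p K) + c = c * p := by
    rw [← absRam_tower, hc]
    obtain ⟨q, hq⟩ := Nat.exists_eq_add_of_le' hpp.one_le
    rw [hq, Nat.add_sub_cancel, mul_add, mul_one]
  obtain ⟨E1⟩ := nonempty_equiv_pi_of_filtration (Twist hχ) (unitBarMod (p := p) (L := L) K (c * p))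
    (c * p) (fun n => ¬ p ∣ n) (unitBarMod_self K _)
    (fun n => unitBarMod_antitone K _ n.le_succ)
    (fun n hn hnc hpn => unitBarMod_le_succ K hc hn hnc (not_not.1 hpn) _)
    (fun n hn hnc hpn => exists_unitBarMod_linearMap K hπ hc hn hnc hpn)
    (Nat.mul_pos hc0 hpp.pos)
  let g : unitBar p K L 1 →ₗ[MonoidAlgebra (ZMod p) Gal(L/K)]
      UnitsModP p L ⧸ unitBar p K L (c * p) :=
    (unitBar p K L (c * p)).mkQ.comp (unitBar p K L 1).subtype
  have hker : LinearMap.ker g = (unitBar p K L (c * p)).submoduleOf (unitBar p K L 1) := by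
    rw [LinearMap.ker_comp, Submodule.ker_mkQ]
    rfl
  have hrange : LinearMap.range g = unitBarMod K (c * p) 1 := by
    rw [LinearMap.range_comp, Submodule.range_subtype]
    rfl
  let E0 : unitBarQuot p K L (c * p) ≃ₗ[MonoidAlgebra (ZMod p) Gal(L/K)]
      unitBarMod (p := p) (L := L) K (c * p) 1 :=
    (Submodule.quotEquivOfEq _ _ hker.symm).trans
      (g.quotKerEquivRange.trans (LinearEquiv.ofEq _ _ hrange))
  obtain ⟨σ, hσ⟩ := exists_equiv_not_dvd hpp hEe
  let E2 := LinearEquiv.piCongrLeft (MonoidAlgebra (ZMod p) Gal(L/K))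
    (fun i : {i // 1 ≤ i ∧ i < c * p ∧ ¬ p ∣ i} => Twist hχ i) σ
  -- The two indices differ by a power of p, so an iterate of Frobenius identifies the twists. The
  -- new indices are consecutive within each block.
  have hfrob : ∀ x : Σ _ : Fin (absRam p K), Fin ((maxIdeal p L).ramificationIdx (IntRing p K)),
      Nonempty (Twist hχ (σ x) ≃ₗ[MonoidAlgebra (ZMod p) Gal(L/K)]
        Twist hχ (c + 1 + (maxIdeal p L).ramificationIdx (IntRing p K) * x.1 + x.2)) := fun x => by
    obtain ⟨u, hu⟩ := hσ x
    rw [hu]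
    exact nonempty_twist_pow_mul_equiv p hχ _ u
  let E3 := LinearEquiv.piCongrRight fun x => (hfrob x).some
  let E4 := LinearEquiv.piCurry (MonoidAlgebra (ZMod p) Gal(L/K))
    (fun (a : Fin (absRam p K)) (b : Fin ((maxIdeal p L).ramificationIdx (IntRing p K))) =>
      Twist hχ (c + 1 + (maxIdeal p L).ramificationIdx (IntRing p K) * a + b))
  let E5 := LinearEquiv.piCongrRight fun a : Fin (absRam p K) =>
    (hblock (c + 1 + (maxIdeal p L).ramificationIdx (IntRing p K) * a)).some
  exact ⟨E0.trans (E1.trans (E2.symm.trans (E3.trans (E4.trans E5))))⟩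

end Freeness

/-! ### Roots of unity and the bottom of the filtration. -/

section Torsion

variable (p : ℕ) [Fact p.Prime] (K L : Type*) [Field K] [Field L] [Algebra K L]
  [Algebra ℚ_[p] K] [Algebra ℚ_[p] L] [IsScalarTower ℚ_[p] K L]
  [Algebra ℤ_[p] K] [IsScalarTower ℤ_[p] ℚ_[p] K]
  [Algebra ℤ_[p] L] [IsScalarTower ℤ_[p] ℚ_[p] L] [IsScalarTower ℤ_[p] K L]
  [FiniteDimensional ℚ_[p] K] [FiniteDimensional ℚ_[p] L]

theorem exists_absRam_eq_mul_of_card_rootsOfUnity (h : Nat.card (rootsOfUnity p L) = p) :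
    ∃ c, absRam p L = c * (p - 1) := by
  have hpp : p.Prime := Fact.out
  obtain ⟨π, hπ⟩ := IsDiscreteValuationRing.exists_irreducible (IntRing p L)
  have : Finite (rootsOfUnity p L) := Nat.finite_of_card_ne_zero (by rw [h]; exact hpp.ne_zero)
  have : Nontrivial (rootsOfUnity p L) := Finite.one_lt_card_iff_nontrivial.1
    (by rw [h]; exact hpp.one_lt)
  obtain ⟨ζ, hζ⟩ := exists_ne (1 : rootsOfUnity p L)
  have hζp : ((ζ : Lˣ) : L) ^ p = 1 := (mem_rootsOfUnity' p _).1 ζ.2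
  have hint : ((ζ : Lˣ) : L) ∈ IntRing p L :=
    IsIntegral.of_pow hpp.pos (by rw [hζp]; exact isIntegral_one)
  refine exists_eq_mul_of_pow_eq_one (p := p) hπ (associated_natCast_pow p L hπ)
    (v := ⟨_, hint⟩) (Subtype.ext hζp) fun h1 => hζ ?_
  exact Subtype.ext (Units.ext (congrArg Subtype.val h1))

theorem unitBar_eq_bot (hroot : rootsOfUnity p L = ⊥) {c : ℕ} (hc : absRam p L = c * (p - 1)) :
    unitBar p K L (c * p) = ⊥ := by
  have hpp : p.Prime := Fact.out
  have hc0 : 0 < c := Nat.pos_of_mul_pos_right (hc ▸ absRam_pos p L)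
  obtain ⟨π, hπ⟩ := IsDiscreteValuationRing.exists_irreducible (IntRing p L)
  rw [Submodule.eq_bot_iff]
  rintro _ ⟨u, hu, rfl⟩
  obtain ⟨y, hy⟩ := (mem_unitGroup_iff_uniformizer hπ (Nat.mul_pos hc0 hpp.pos) _).1 hu
  obtain ⟨x, hx⟩ := exists_pow_eq_of_level (p := p) hπ hc0 (hc ▸ associated_natCast_pow p L hπ)
    (fun v hv => by
      have hv' : (v : L) ^ p = 1 := congrArg Subtype.val hv
      have h1 : Units.ofPowEqOne _ p hv' hpp.ne_zero ∈ rootsOfUnity p L :=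
        (mem_rootsOfUnity' p _).2 hv'
      rw [hroot, Subgroup.mem_bot] at h1
      exact Subtype.ext (congrArg Units.val h1)) y
  obtain ⟨v, -, hv⟩ := exists_unit_eq hπ hc0 x
  refine Eq.trans ?_ (map_zero (toUnitsModP p L))
  refine ((toUnitsModP_eq_iff p L 1 u.toMul).2 ⟨v, Units.ext ?_⟩).symm
  rw [one_mul, Units.val_pow_eq_pow_val, hv, ← SubmonoidClass.coe_pow, hx]
  exact hy

/-- Every integral unit is a principal unit up to `p`-th powers. -/
theorem unitBar_one_eq_intUnitsBar : unitBar p K L 1 = intUnitsBar p K L := by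
  obtain ⟨π, hπ⟩ := IsDiscreteValuationRing.exists_irreducible (IntRing p L)
  refine le_antisymm ?_ ?_
  · rintro _ ⟨u, ⟨v, -, hv⟩, rfl⟩
    exact ⟨u, ⟨v, hv⟩, rfl⟩
  · rintro _ ⟨u, ⟨v, hv⟩, rfl⟩
    -- A p-th root of the inverse residue lifts to a unit whose p-th power moves v into the
    -- principal units.
    obtain ⟨z, hz⟩ := (bijective_frobenius (ResField p L) p).2 (residue _ (v⁻¹ : (IntRing p L)ˣ))
    obtain ⟨y, rfl⟩ := residue_surjective z
    rw [frobenius_def, ← map_pow] at hz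
    have hyu : IsUnit (y ^ p) := by
      rw [← residue_ne_zero_iff_isUnit, hz, residue_ne_zero_iff_isUnit]
      exact Units.isUnit _
    have hy : IsUnit y := (isUnit_pow_iff (Fact.out : p.Prime).ne_zero).1 hyu
    let w : Lˣ := Units.map ((IntRing p L).val : IntRing p L →* L) hy.unit
    refine ⟨.ofMul (u.toMul * w ^ p), ?_, ((toUnitsModP_eq_iff p L _ _).2 ⟨w, rfl⟩).symm⟩
    refine (mem_unitGroup_iff_uniformizer hπ one_pos _).2 ?_
    have h1 : π ∣ v * y ^ p - 1 := by
      rw [← residue_eq_zero_iff_dvd hπ, map_sub, map_mul, hz, ← map_mul, Units.mul_inv, sub_self]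
    obtain ⟨d, hd⟩ := h1
    refine ⟨d, ?_⟩
    rw [pow_one, ← hd, add_sub_cancel]
    change ((u.toMul * w ^ p : Lˣ) : L) = _
    rw [← hv]
    simp [w]

end Torsion

end

end LocalGalMod

theorem mainTheorem12 (p : ℕ) [Fact p.Prime]
    (K L : Type*) [Field K] [Field L] [Algebra K L]
    [Algebra ℚ_[p] K] [Algebra ℚ_[p] L] [IsScalarTower ℚ_[p] K L]
    [Algebra ℤ_[p] K] [IsScalarTower ℤ_[p] ℚ_[p] K]
    [Algebra ℤ_[p] L] [IsScalarTower ℤ_[p] ℚ_[p] L] [IsScalarTower ℤ_[p] K L]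
    [FiniteDimensional ℚ_[p] K] [FiniteDimensional ℚ_[p] L] [IsGalois K L]
    (htame : IsTame p K L) (hsplit : IsSplitExt p K L) :
    -- first part: `L` has exactly `p` elements of `p`-torsion in `L^×`
    (Nat.card (rootsOfUnity p L) = p →
      ∃ c : ℕ, absRam p L = c * (p - 1) ∧
        Nonempty
          (ScalarExt
              (MonoidAlgebra.mapRingHom Gal(L/K)
                (algebraMap (ZMod p) (AlgebraicClosure (ZMod p))))
              (unitBarQuot p K L (c * p))
            ≃ₗ[MonoidAlgebra (AlgebraicClosure (ZMod p)) Gal(L/K)]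
              (Fin (Module.finrank ℚ_[p] K) →
                MonoidAlgebra (AlgebraicClosure (ZMod p)) Gal(L/K)))) ∧
    -- second part: `L^×` has no `p`-torsion, but `p - 1` divides `e_L`
    (rootsOfUnity p L = ⊥ → (p - 1) ∣ absRam p L →
      unitBar p K L 1 = intUnitsBar p K L ∧
      Nonempty
        (unitBar p K L 1 ≃ₗ[MonoidAlgebra (ZMod p) Gal(L/K)]
          (Fin (absRam p K) → MonoidAlgebra (ResField p K) Gal(L/K))) ∧
      Nonempty
        (unitBar p K L 1 ≃ₗ[MonoidAlgebra (ZMod p) Gal(L/K)]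
          (Fin (Module.finrank ℚ_[p] K) → MonoidAlgebra (ZMod p) Gal(L/K)))) := by

  constructor
  · intro h
    obtain ⟨c, hc⟩ := exists_absRam_eq_mul_of_card_rootsOfUnity p L h
    obtain ⟨E⟩ := nonempty_unitBarQuot_equiv p K L htame hsplit hc
    obtain ⟨E'⟩ := nonempty_pi_monoidAlgebra_equiv p K L
    -- The quotient is already free over F_p[G], so extending scalars to the algebraic closure
    -- preserves freeness and rank.
    exact ⟨c, hc, nonempty_scalarExt_equiv _ _ (E.trans E')⟩
  · rintro hroot ⟨c, hc⟩
    rw [mul_comm] at hc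
    obtain ⟨E⟩ := nonempty_unitBarQuot_equiv p K L htame hsplit hc
    obtain ⟨E'⟩ := nonempty_pi_monoidAlgebra_equiv p K L
    have hbot : (unitBar p K L (c * p)).submoduleOf (unitBar p K L 1) = ⊥ := by
      rw [unitBar_eq_bot p K L hroot hc]
      exact Submodule.ker_subtype _
    have E0 := (Submodule.quotEquivOfEqBot _ hbot).symm
    exact ⟨unitBar_one_eq_intUnitsBar p K L, ⟨E0.trans E⟩, ⟨E0.trans (E.trans E')⟩⟩
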